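/- Let $n\ge 0$, let $\mathfrak g=\mathfrak{sl}_{n+1}(\mathbb C)$ and let $V=\mathbb C^{n+1}$ be its natural module, with standard basis $a_1,\dots,a_{n+1}$. Let $\mathfrak h\subset\mathfrak g$ be the diagonal matrices, with weights $\theta_i(h)=h_{ii}$. Let $\tau$ be the anti-automorphism of the enveloping algebra $\mathfrak U=\mathfrak U(\mathfrak g)$ that extends transposition, i.e. $X_\alpha\mapsto Y_\alpha$, $Y_\alpha\mapsto X_\alpha$, $H_\alpha\mapsto H_\alpha$ on the usual Chevalley basis. A bilinear form $\beta$ on a $\mathfrak g$-module is \emph{$\tau$-contravariant} if $\beta(ux,y)=\beta(x,u^\tau y)$ for all $u\in\mathfrak U$. For an irreducible module $W$ with highest weight $\mu$ and highest weight vector $v^+$, let $f^+\in W^*$ be the functional with $f^+(cv^++w)=c$ for $c\in\mathbb C$ and $w\in\bigoplus_{\nu\ne\mu}W_\nu$. \emph{The contravariant form} on $W$ (with respect to $v^+$) is $\beta(x,y)=\phi(x)(y)$, where $\phi\colon W\to W^*$ is the isomorphism of $\mathfrak U$-modules with $\phi(uv^+)=u\cdot f^+$, and $W^*$ carries the twisted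 action $(u\cdot f)(x)=f(u^\tau x)$. Let $\lambda$ be a Young diagram with $d$ boxes and at most $n+1$ rows, with row lengths $r_1\ge r_2\ge\cdots$. Let $U$ be a numbering of its boxes by $1,\dots,d$ (for instance the one whose column word is $1,2,\dots,d$), with row group $R(U)$ and column group $C(U)$ in $S_d$. In $\mathbf C=\mathbb C[S_d]$ put $\rho_U=\sum_{\rho\in R(U)}\rho$, $\gamma_U=\sum_{\gamma\in C(U)}\mathrm{sign}(\gamma)\gamma$, $\sigma_U=\gamma_U\rho_U$. Let $S_d$ act on $V^{\otimes d}$ from the right by $(v_1\otimes\cdots\otimes v_d)\cdot s=v_{s(1)}\otimes\cdots\otimes v_{s(d)}$, and let $V^\lambda=V^{\otimes d}\otimes_{\mathbf C}\mathbf C\sigma_U$, with $\mathfrak g$ acting by derivations on $V^{\otimes d}$. Let $v^+_\lambda=a_{T(1)}\otimes\cdots\otimes a_{T(d)}\otimes\sigma_U$, where $T(i)$ is the row of the box numbered $i$. Then: 1. The contravariant form $\beta$ on $V$ with respect to $a_1$ (a highest weight vector of weight $\theta_1$) exists and is unique. 2. $V^\lambda$ is an irreducible $\mathfrak g$-module with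 highest weight $\sum_i r_i\theta_i$ and highest weight vector $v^+_\lambda$. 3. There is a non-zero integer $k_\lambda$ with $\sigma_U^2=k_\lambda\sigma_U$. 4. There is a unique bilinear form $\beta^\lambda$ on $V^\lambda$ such that for all $v_i,u_i\in V$ $$\beta^\lambda(v_1\otimes\cdots\otimes v_d\otimes\sigma_U,\;u_1\otimes\cdots\otimes u_d\otimes\sigma_U)=\sum_{\gamma\in C(U)}\sum_{\rho\in R(U)}\sum_{\tilde\gamma\in C(U)}\mathrm{sign}(\gamma)\,\mathrm{sign}(\tilde\gamma)\prod_{i=1}^d\beta(v_{(\gamma\rho\tilde\gamma)(i)},u_i).$$ 5. $\frac1{k_\lambda}\beta^\lambda$ is the contravariant form on $V^\lambda$ with respect to $v^+_\lambda$. It is symmetric and $\tau$-contravariant, takes the value $1$ at $(v^+_\lambda,v^+_\lambda)$, and is the only $\tau$-contravariant bilinear form on $V^\lambda$ that takes this value there. -/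

import Mathlib

open scoped TensorProduct

noncomputable section

namespace SchurForm

attribute [local instance 100] LieRing.ofAssociativeRing

/-! ### The Lie algebra `sl_{n+1}(ℂ)`, its anti-automorphism `τ`, weights -/

/-- The complex simple Lie algebra of type `A_n`. -/
abbrev sl (n : ℕ) : LieSubalgebra ℂ (Matrix (Fin (n + 1)) (Fin (n + 1)) ℂ) :=
  LieAlgebra.SpecialLinear.sl (Fin (n + 1)) ℂ

/-- The Cartan subalgebra of diagonal matrices. -/
def cartan (n : ℕ) : Submodule ℂ (sl n) where
  carrier := {h | (h : Matrix (Fin (n + 1)) (Fin (n + 1)) ℂ).IsDiag}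
  add_mem' := fun ha hb => Matrix.IsDiag.add ha hb
  zero_mem' := Matrix.isDiag_zero
  smul_mem' := fun c _ hx => Matrix.IsDiag.smul c hx

/-- The linear map `τ` with `X_α ↦ Y_α`, `Y_α ↦ X_α`, `H_α ↦ H_α` for the Chevalley basis
`E_{ij}`, `E_{ji}` (`i < j`), `E_{ii} - E_{jj}`: the transposition. -/
def tau (n : ℕ) : sl n →ₗ[ℂ] sl n where
  toFun x := ⟨(x : Matrix (Fin (n + 1)) (Fin (n + 1)) ℂ).transpose, by
    have hx : Matrix.trace (x : Matrix (Fin (n + 1)) (Fin (n + 1)) ℂ) = 0 := x.2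
    change Matrix.trace (x : Matrix (Fin (n + 1)) (Fin (n + 1)) ℂ).transpose = 0
    rw [Matrix.trace_transpose, hx]⟩
  map_add' x y := Subtype.ext (Matrix.transpose_add _ _)
  map_smul' c x := Subtype.ext (Matrix.transpose_smul _ _)

/-- The universal enveloping algebra of `sl_{n+1}(ℂ)`. -/
abbrev Env (n : ℕ) : Type := UniversalEnvelopingAlgebra ℂ (sl n)

theorem tau_lie (n : ℕ) (x y : sl n) : tau n ⁅x, y⁆ = ⁅tau n y, tau n x⁆ := by
  apply Subtype.ext
  change (_ * _ - _ * _ : Matrix (Fin (n + 1)) (Fin (n + 1)) ℂ).transpose = _ * _ - _ * _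
  rw [Matrix.transpose_sub, Matrix.transpose_mul, Matrix.transpose_mul]
  rfl

/-- `τ` followed by the embedding into the enveloping algebra, as a Lie algebra homomorphism to
the opposite of the enveloping algebra. -/
def tauLie (n : ℕ) : sl n →ₗ⁅ℂ⁆ (Env n)ᵐᵒᵖ where
  toFun x := MulOpposite.op (UniversalEnvelopingAlgebra.ι ℂ (tau n x))
  map_add' x y := by simp only [map_add, MulOpposite.op_add]
  map_smul' c x := by simp only [map_smul, MulOpposite.op_smul, RingHom.id_apply]
  map_lie' := by
    intro x y
    change MulOpposite.op (UniversalEnvelopingAlgebra.ι ℂ (tau n ⁅x, y⁆)) = _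
    rw [tau_lie, LieHom.map_lie, LieRing.of_associative_ring_bracket,
      LieRing.of_associative_ring_bracket, MulOpposite.op_sub, MulOpposite.op_mul,
      MulOpposite.op_mul]

/-- The extension `u ↦ u^τ` of `τ` to an anti-automorphism of the enveloping algebra. -/
def tauEnv (n : ℕ) (u : Env n) : Env n :=
  MulOpposite.unop (UniversalEnvelopingAlgebra.lift ℂ (tauLie n) u)

section Modules

variable (n : ℕ) {V : Type*} [AddCommGroup V] [Module ℂ V] [LieRingModule (sl n) V]
  [LieModule ℂ (sl n) V]

/-- The action of the enveloping algebra on an `sl_{n+1}`-module. -/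
def envAct (u : Env n) : Module.End ℂ V :=
  UniversalEnvelopingAlgebra.lift ℂ (LieModule.toEnd ℂ (sl n) V) u

/-- The weight space of weight `μ`. -/
def weightSpace (V : Type*) [AddCommGroup V] [Module ℂ V] [LieRingModule (sl n) V]
    [LieModule ℂ (sl n) V] (μ : Module.Dual ℂ (cartan n)) : Submodule ℂ V where
  carrier := {v | ∀ h : cartan n, ⁅(h : sl n), v⁆ = μ h • v}
  add_mem' := fun ha hb h => by rw [lie_add, ha h, hb h, smul_add]
  zero_mem' := fun h => by rw [lie_zero, smul_zero]
  smul_mem' := fun c v hv h => by rw [lie_smul, hv h, smul_comm]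

/-- `V` is an irreducible `sl_{n+1}`-module with highest weight `wt` and highest weight vector
`vp`, i.e. a realisation of the module `V(wt)`. -/
structure IsIrreducibleHighestWeight (wt : Module.Dual ℂ (cartan n)) (vp : V) : Prop where
  irreducible : LieModule.IsIrreducible ℂ (sl n) V
  ne_zero : vp ≠ 0
  weight : vp ∈ weightSpace n V wt
  raising : ∀ (i j : Fin (n + 1)) (hij : i < j),
    ⁅LieAlgebra.SpecialLinear.single i j hij.ne (1 : ℂ), vp⁆ = 0

/-- `β` is `τ`-contravariant: `β(u x, y) = β(x, u^τ y)` for all `u` in the enveloping algebra. -/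
def IsContravariant (β : LinearMap.BilinForm ℂ V) : Prop :=
  ∀ (u : Env n) (x y : V), β (envAct n u x) y = β x (envAct n (tauEnv n u) y)

/-- The twisted action `(u · f)(v) = f(u^τ v)` on the dual space. -/
def twistedAct (u : Env n) (f : Module.Dual ℂ V) : Module.Dual ℂ V :=
  f ∘ₗ envAct n (tauEnv n u)

/-- For a module `V` generated by a highest weight vector `v⁺ = vp` of weight `wt`, this says that
`β` is the form `β(x, y) = φ(x)(y)`, where `φ` is the isomorphism of modules over the enveloping
algebra from `V` to its `τ`-twisted dual that sends `u v⁺` to `u f⁺`, and `f⁺` is the functional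
with `f⁺(c v⁺ + w) = c` for every `w` in the sum of the weight spaces of weight different from
`wt`. -/
def IsTheContravariantForm (wt : Module.Dual ℂ (cartan n)) (vp : V)
    (β : LinearMap.BilinForm ℂ V) : Prop :=
  ∃ (fp : Module.Dual ℂ V) (φ : V ≃ₗ[ℂ] Module.Dual ℂ V),
    (∀ (c : ℂ), ∀ w ∈ ⨆ (μ : Module.Dual ℂ (cartan n)) (_ : μ ≠ wt), weightSpace n V μ,
      fp (c • vp + w) = c) ∧
    (∀ (u : Env n) (x : V), φ (envAct n u x) = twistedAct n u (φ x)) ∧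
    (∀ u : Env n, φ (envAct n u vp) = twistedAct n u fp) ∧
    ∀ x y : V, β x y = φ x y

end Modules

/-! ### The Young symmetrizer -/

section Symmetrizer

variable {lam : YoungDiagram} {d : ℕ}

/-- The row (counted from `0`) of the box numbered `i`. -/
def rowOf (U : lam.cells ≃ Fin d) (i : Fin d) : ℕ := (U.symm i : ℕ × ℕ).1

/-- The column (counted from `0`) of the box numbered `i`. -/
def colOf (U : lam.cells ≃ Fin d) (i : Fin d) : ℕ := (U.symm i : ℕ × ℕ).2

/-- The row group `R(U)`. -/
def rowGroup (U : lam.cells ≃ Fin d) : Subgroup (Equiv.Perm (Fin d)) where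
  carrier := {s | ∀ i, rowOf U (s i) = rowOf U i}
  mul_mem' := fun {a b} ha hb i => (ha (b i)).trans (hb i)
  one_mem' := fun _ => rfl
  inv_mem' := fun {a} ha i => by
    have h := ha (a⁻¹ i)
    have e : a (a⁻¹ i) = i := Equiv.apply_symm_apply a i
    rw [e] at h
    exact h.symm

/-- The column group `C(U)`. -/
def colGroup (U : lam.cells ≃ Fin d) : Subgroup (Equiv.Perm (Fin d)) where
  carrier := {s | ∀ i, colOf U (s i) = colOf U i}
  mul_mem' := fun {a b} ha hb i => (ha (b i)).trans (hb i)
  one_mem' := fun _ => rfl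
  inv_mem' := fun {a} ha i => by
    have h := ha (a⁻¹ i)
    have e : a (a⁻¹ i) = i := Equiv.apply_symm_apply a i
    rw [e] at h
    exact h.symm

instance (U : lam.cells ≃ Fin d) : DecidablePred (· ∈ rowGroup U) :=
  fun s => inferInstanceAs (Decidable (∀ i, rowOf U (s i) = rowOf U i))

instance (U : lam.cells ≃ Fin d) : DecidablePred (· ∈ colGroup U) :=
  fun s => inferInstanceAs (Decidable (∀ i, colOf U (s i) = colOf U i))

/-- The complex group algebra of the symmetric group. -/
abbrev GroupAlg (d : ℕ) : Type := MonoidAlgebra ℂ (Equiv.Perm (Fin d))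

/-- `sign γ` as a complex number. -/
def sgn (g : Equiv.Perm (Fin d)) : ℂ := ((Equiv.Perm.sign g : ℤ) : ℂ)

/-- `ρ_U`, the sum of the elements of the row group. -/
def rowSum (U : lam.cells ≃ Fin d) : GroupAlg d :=
  ∑ r : rowGroup U, MonoidAlgebra.single (r : Equiv.Perm (Fin d)) 1

/-- `γ_U`, the signed sum of the elements of the column group. -/
def colSum (U : lam.cells ≃ Fin d) : GroupAlg d :=
  ∑ c : colGroup U, MonoidAlgebra.single (c : Equiv.Perm (Fin d)) (sgn (c : Equiv.Perm (Fin d)))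

/-- The Young symmetrizer `σ_U = γ_U ρ_U`. -/
def youngSym (U : lam.cells ≃ Fin d) : GroupAlg d := colSum U * rowSum U

/-- The Specht module as the left ideal `ℂ[S_d] σ_U`. -/
def specht (U : lam.cells ≃ Fin d) : Submodule (GroupAlg d) (GroupAlg d) :=
  Submodule.span (GroupAlg d) {youngSym U}

/-- `σ_U` as an element of the Specht module. -/
def youngSymMem (U : lam.cells ≃ Fin d) : specht U :=
  ⟨youngSym U, Submodule.mem_span_singleton_self _⟩

end Symmetrizer

/-! ### The Schur module `V^{⊗ d} ⊗_{ℂ[S_d]} ℂ[S_d] σ_U` -/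

section Schur

variable {lam : YoungDiagram} {d : ℕ}

/-- `V^{⊗ d}`. -/
abbrev TPow (d : ℕ) (V : Type*) [AddCommGroup V] [Module ℂ V] : Type _ :=
  PiTensorProduct ℂ (fun _ : Fin d => V)

/-- The right action of `S_d` on `V^{⊗ d}`:
`(v_1 ⊗ ⋯ ⊗ v_d) · s = v_{s(1)} ⊗ ⋯ ⊗ v_{s(d)}`. -/
def permAct (V : Type*) [AddCommGroup V] [Module ℂ V] (s : Equiv.Perm (Fin d)) :
    TPow d V →ₗ[ℂ] TPow d V :=
  (PiTensorProduct.reindex ℂ (fun _ : Fin d => V) s.symm).toLinearMap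

theorem permAct_tprod (V : Type*) [AddCommGroup V] [Module ℂ V] (s : Equiv.Perm (Fin d))
    (v : Fin d → V) :
    permAct V s (PiTensorProduct.tprod ℂ v) = PiTensorProduct.tprod ℂ (fun i => v (s i)) :=
  PiTensorProduct.reindex_tprod _ _

/-- The subspace of `V^{⊗ d} ⊗_ℂ ℂ[S_d] σ_U` spanned by all `(a · s) ⊗ b - a ⊗ (s · b)`. -/
def balanced (U : lam.cells ≃ Fin d) (V : Type*) [AddCommGroup V] [Module ℂ V] :
    Submodule ℂ (TPow d V ⊗[ℂ] specht U) :=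
  Submodule.span ℂ {z | ∃ (a : TPow d V) (s : Equiv.Perm (Fin d)) (b : specht U),
    z = permAct V s a ⊗ₜ[ℂ] b - a ⊗ₜ[ℂ] ((MonoidAlgebra.single s (1 : ℂ) : GroupAlg d) • b)}

/-- The Schur module `V^λ = V^{⊗ d} ⊗_{ℂ[S_d]} ℂ[S_d] σ_U`. -/
def SchurModule (U : lam.cells ≃ Fin d) (V : Type*) [AddCommGroup V] [Module ℂ V] : Type _ :=
  (TPow d V ⊗[ℂ] specht U) ⧸ balanced U V

variable (U : lam.cells ≃ Fin d) {V : Type*} [AddCommGroup V] [Module ℂ V]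

instance : AddCommGroup (SchurModule U V) :=
  inferInstanceAs (AddCommGroup ((TPow d V ⊗[ℂ] specht U) ⧸ balanced U V))

instance : Module ℂ (SchurModule U V) :=
  inferInstanceAs (Module ℂ ((TPow d V ⊗[ℂ] specht U) ⧸ balanced U V))

/-- The quotient map `V^{⊗ d} ⊗_ℂ ℂ[S_d] σ_U → V^{⊗ d} ⊗_{ℂ[S_d]} ℂ[S_d] σ_U`. -/
def schurProj (V : Type*) [AddCommGroup V] [Module ℂ V] :
    TPow d V ⊗[ℂ] specht U →ₗ[ℂ] SchurModule U V :=
  (balanced U V).mkQ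

/-- The element `v_1 ⊗ ⋯ ⊗ v_d ⊗ σ_U` of the Schur module. -/
def schurMk (v : Fin d → V) : SchurModule U V :=
  schurProj U V (PiTensorProduct.tprod ℂ v ⊗ₜ[ℂ] youngSymMem U)

/-! The Lie algebra action. -/

/-- `v_1 ⊗ ⋯ ⊗ v_d ↦ v_1 ⊗ ⋯ ⊗ f v_i ⊗ ⋯ ⊗ v_d`. -/
def slotAct (d : ℕ) (i : Fin d) (f : Module.End ℂ V) : Module.End ℂ (TPow d V) :=
  PiTensorProduct.map (Function.update (fun _ => (1 : Module.End ℂ V)) i f)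

theorem slotAct_add (i : Fin d) (f g : Module.End ℂ V) :
    slotAct d i (f + g) = slotAct d i f + slotAct d i g :=
  PiTensorProduct.map_update_add _ _ _ _

theorem slotAct_smul (i : Fin d) (c : ℂ) (f : Module.End ℂ V) :
    slotAct d i (c • f) = c • slotAct d i f :=
  PiTensorProduct.map_update_smul _ _ _ _

theorem slotAct_mul (i : Fin d) (f g : Module.End ℂ V) :
    slotAct d i f * slotAct d i g = slotAct d i (f * g) := by
  unfold slotAct
  rw [← PiTensorProduct.map_mul]
  congr 1
  funext j
  by_cases h : j = i
  · subst h; simp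
  · simp [Function.update_of_ne h]

theorem slotAct_comm {i j : Fin d} (hij : i ≠ j) (f g : Module.End ℂ V) :
    slotAct d i f * slotAct d j g = slotAct d j g * slotAct d i f := by
  unfold slotAct
  rw [← PiTensorProduct.map_mul, ← PiTensorProduct.map_mul]
  congr 1
  funext k
  by_cases h : k = i
  · subst h; simp [Function.update_of_ne hij]
  · by_cases h' : k = j
    · subst h'; simp [Function.update_of_ne h]
    · simp [Function.update_of_ne h, Function.update_of_ne h']

/-- The derivation action `v_1 ⊗ ⋯ ⊗ v_d ↦ ∑_i v_1 ⊗ ⋯ ⊗ f v_i ⊗ ⋯ ⊗ v_d`. -/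
def tensorAct (d : ℕ) (f : Module.End ℂ V) : Module.End ℂ (TPow d V) :=
  ∑ i : Fin d, slotAct d i f

theorem tensorAct_tprod (f : Module.End ℂ V) (v : Fin d → V) :
    tensorAct d f (PiTensorProduct.tprod ℂ v) =
      ∑ i : Fin d, PiTensorProduct.tprod ℂ (Function.update v i (f (v i))) := by
  unfold tensorAct slotAct
  rw [LinearMap.sum_apply]
  refine Finset.sum_congr rfl fun i _ => ?_
  rw [PiTensorProduct.map_tprod]
  congr 1
  funext j
  by_cases h : j = i
  · subst h; simp
  · simp [Function.update_of_ne h]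

theorem tensorAct_bracket (f g : Module.End ℂ V) :
    tensorAct d (f * g - g * f) =
      tensorAct d f * tensorAct d g - tensorAct d g * tensorAct d f := by
  have hsub : ∀ i : Fin d, slotAct d i (f * g - g * f) =
      slotAct d i (f * g) - slotAct d i (g * f) := by
    intro i
    rw [eq_sub_iff_add_eq, ← slotAct_add, sub_add_cancel]
  unfold tensorAct
  rw [Finset.sum_mul_sum, Finset.sum_mul_sum,
    Finset.sum_comm (f := fun i j => slotAct d i g * slotAct d j f), ← Finset.sum_sub_distrib]
  refine Finset.sum_congr rfl fun i _ => ?_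
  rw [← Finset.sum_sub_distrib, Finset.sum_eq_single i]
  · rw [slotAct_mul, slotAct_mul, hsub]
  · intro j _ hj
    rw [slotAct_comm hj.symm, sub_self]
  · intro h
    exact absurd (Finset.mem_univ i) h

theorem tensorAct_permAct (f : Module.End ℂ V) (s : Equiv.Perm (Fin d)) (a : TPow d V) :
    tensorAct d f (permAct V s a) = permAct V s (tensorAct d f a) := by
  have h : tensorAct d f ∘ₗ permAct V s = permAct V s ∘ₗ tensorAct d f := by
    apply PiTensorProduct.ext
    ext v
    simp only [LinearMap.compMultilinearMap_apply, LinearMap.comp_apply, permAct_tprod,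
      tensorAct_tprod, map_sum]
    refine Fintype.sum_equiv s _ _ fun i => ?_
    congr 1
    funext j
    by_cases hj : j = i
    · subst hj; simp
    · have hs : s j ≠ s i := fun e => hj (s.injective e)
      rw [Function.update_of_ne hj, Function.update_of_ne hs]
  exact LinearMap.congr_fun h a

/-- The operator induced by `f ∈ End V` (acting by derivations on `V^{⊗ d}`) on `V^λ`. -/
def schurAct (f : Module.End ℂ V) : Module.End ℂ (SchurModule U V) :=
  (balanced U V).mapQ (balanced U V) (TensorProduct.map (tensorAct d f) LinearMap.id) (by
    unfold balanced
    rw [Submodule.span_le]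
    rintro z ⟨a, s, b, rfl⟩
    apply Submodule.subset_span
    refine ⟨tensorAct d f a, s, b, ?_⟩
    rw [map_sub, TensorProduct.map_tmul, TensorProduct.map_tmul, tensorAct_permAct]
    rfl)

theorem schurAct_mk (f : Module.End ℂ V) (z : TPow d V ⊗[ℂ] specht U) :
    schurAct U f (schurProj U V z) =
      schurProj U V (TensorProduct.map (tensorAct d f) LinearMap.id z) := rfl

theorem schurProj_surjective (x : SchurModule U V) :
    ∃ z : TPow d V ⊗[ℂ] specht U, schurProj U V z = x :=
  Submodule.mkQ_surjective _ x

theorem schurAct_add (f g : Module.End ℂ V) :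
    schurAct U (f + g) = schurAct U f + schurAct U g := by
  ext x
  obtain ⟨z, rfl⟩ := schurProj_surjective U x
  rw [LinearMap.add_apply, schurAct_mk, schurAct_mk, schurAct_mk]
  have h : tensorAct d (f + g) = tensorAct d f + tensorAct d g := by
    unfold tensorAct
    simp only [slotAct_add, Finset.sum_add_distrib]
  rw [h, TensorProduct.map_add_left, LinearMap.add_apply, map_add]

theorem schurAct_smul (c : ℂ) (f : Module.End ℂ V) :
    schurAct U (c • f) = c • schurAct U f := by
  ext x
  obtain ⟨z, rfl⟩ := schurProj_surjective U x
  rw [LinearMap.smul_apply, schurAct_mk, schurAct_mk]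
  have h : tensorAct d (c • f) = c • tensorAct d f := by
    unfold tensorAct
    simp only [slotAct_smul, Finset.smul_sum]
  rw [h, TensorProduct.map_smul_left, LinearMap.smul_apply, map_smul]

theorem schurAct_bracket (f g : Module.End ℂ V) :
    schurAct U (f * g - g * f) =
      schurAct U f * schurAct U g - schurAct U g * schurAct U f := by
  ext x
  obtain ⟨z, rfl⟩ := schurProj_surjective U x
  rw [LinearMap.sub_apply, Module.End.mul_apply, Module.End.mul_apply]
  simp only [schurAct_mk]
  rw [tensorAct_bracket]
  induction z using TensorProduct.induction_on with
  | zero => simp only [map_zero]; exact (sub_self _).symm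
  | tmul a b =>
    simp only [TensorProduct.map_tmul, LinearMap.sub_apply, Module.End.mul_apply,
      LinearMap.id_apply, TensorProduct.sub_tmul, map_sub]
  | add z w hz hw =>
    simp only [map_add] at hz hw ⊢
    rw [hz, hw]
    exact (add_sub_add_comm _ _ _ _).symm

section LieAction

variable {L : Type*} [LieRing L] [LieAlgebra ℂ L] [LieRingModule L V] [LieModule ℂ L V]

/-- `x · (v_1 ⊗ ⋯ ⊗ v_d ⊗ σ_U) = ∑_i v_1 ⊗ ⋯ ⊗ x v_i ⊗ ⋯ ⊗ v_d ⊗ σ_U`. -/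
instance : LieRingModule L (SchurModule U V) where
  bracket x m := schurAct U (LieModule.toEnd ℂ L V x) m
  add_lie x y m := by
    rw [map_add, schurAct_add]
    rfl
  lie_add x m m' := map_add _ m m'
  leibniz_lie x y m := by
    change schurAct U (LieModule.toEnd ℂ L V x) (schurAct U (LieModule.toEnd ℂ L V y) m) =
      schurAct U (LieModule.toEnd ℂ L V ⁅x, y⁆) m +
        schurAct U (LieModule.toEnd ℂ L V y) (schurAct U (LieModule.toEnd ℂ L V x) m)
    rw [LieHom.map_lie, LieRing.of_associative_ring_bracket, schurAct_bracket]
    exact (sub_add_cancel _ _).symm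

instance : LieModule ℂ L (SchurModule U V) where
  smul_lie c x m := by
    change schurAct U (LieModule.toEnd ℂ L V (c • x)) m = _
    rw [map_smul, schurAct_smul]
    rfl
  lie_smul c x m := map_smul (schurAct U (LieModule.toEnd ℂ L V x)) c m

end LieAction

/-- `F` is the bilinear form `ζ^λ` on `V^λ` built from the bilinear form `ζ` on `V`. -/
def IsSchurForm (ζ : LinearMap.BilinForm ℂ V) (F : LinearMap.BilinForm ℂ (SchurModule U V)) :
    Prop :=
  ∀ v u : Fin d → V,
    F (schurMk U v) (schurMk U u) =
      ∑ c : colGroup U, ∑ r : rowGroup U, ∑ c' : colGroup U,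
        sgn (c : Equiv.Perm (Fin d)) * sgn (c' : Equiv.Perm (Fin d)) *
          ∏ i : Fin d, ζ (v (((c : Equiv.Perm (Fin d)) * (r : Equiv.Perm (Fin d)) *
            (c' : Equiv.Perm (Fin d))) i)) (u i)

end Schur

/-! ### The natural module and the highest weight data -/

/-- The natural module of `sl_{n+1}(ℂ)`. -/
abbrev NatMod (n : ℕ) : Type := Fin (n + 1) → ℂ

/-- The standard basis vector `a_{i+1}`, with `i` counted from `0` (and `0` if `i > n`). -/
def basisVec (n : ℕ) (i : ℕ) : NatMod n := fun j => if (j : ℕ) = i then 1 else 0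

/-- The weight `∑_i r_i θ_i`, where `θ_i(h)` is the `i`-th diagonal entry of `h`. -/
def diagWeight (n : ℕ) (r : Fin (n + 1) → ℕ) : Module.Dual ℂ (cartan n) where
  toFun h := ∑ i, (r i : ℂ) * ((h : sl n) : Matrix (Fin (n + 1)) (Fin (n + 1)) ℂ) i i
  map_add' h h' := by
    rw [← Finset.sum_add_distrib]
    exact Finset.sum_congr rfl fun i _ => mul_add _ _ _
  map_smul' c h := by
    rw [RingHom.id_apply, Finset.smul_sum]
    exact Finset.sum_congr rfl fun i _ => mul_left_comm _ _ _

/-- The fundamental weight `λ_1 = θ_1`, the highest weight of the natural module. -/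
def firstWeight (n : ℕ) : Module.Dual ℂ (cartan n) :=
  diagWeight n (fun i => if i = 0 then 1 else 0)

/-- The weight of a Young diagram: with `l_k` columns of length `k`, it is
`∑_k l_k λ_k = ∑_k l_k (θ_1 + ⋯ + θ_k) = ∑_i r_i θ_i`, with `r_i` the length of row `i`. -/
def diagramWeight (n : ℕ) (lam : YoungDiagram) : Module.Dual ℂ (cartan n) :=
  diagWeight n (fun i => lam.rowLen i)

/-- The vector `a_T = a_{T(1)} ⊗ ⋯ ⊗ a_{T(d)} ⊗ σ_U` of `V^λ`, where `V` is the natural module and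
`T` is the tableau of shape `λ` whose `i`-th row is filled with `i`'s. -/
def schurVec (n : ℕ) {lam : YoungDiagram} {d : ℕ} (U : lam.cells ≃ Fin d) :
    SchurModule U (NatMod n) :=
  schurMk U (fun i => basisVec n (rowOf U i))

end SchurForm

end

/-! On a finite-dimensional irreducible module a contravariant form is determined by its value at
the highest weight vector, as soon as that value is 1. Its radical is a submodule, so a nonzero form
is nondegenerate, and Schur's lemma makes two such forms proportional. Weight spaces of different
weights are orthogonal, since `τ` fixes diagonal matrices, so `x ↦ β(x, ·)` is itself the
isomorphism `φ` and sends `v⁺` to `f⁺`. Hence the form on `V` is the dot product, and only a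
contravariant form on `V^λ` with the right value remains to be found.

Write `γ`, `ρ`, `σ = γρ`. On `V^{⊗d}` the product form makes the adjoint of a group algebra element
its image under inversion. The form `(w ⊗ σ, u ⊗ σ) ↦ ⟨w·γρ γ, u⟩` expands to the triple sum. It is
symmetric because `γργ` is fixed by inversion, and contravariant because derivations commute with
permutations. Its value at `v⁺` is the identity coefficient of `γργρ = σ²`, that is `k`
(`schurForm_schurVec`).

Von Neumann's lemma (`colSum_mul_mul_rowSum`) gives `σ² = kσ`, and more generally `σxσ ∈ ℂσ`. If `k`
vanished, `γργ` would square to zero; but its coefficients are integers and it is fixed by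
inversion, so the identity coefficient of its square is a sum of squares, one of them `|C(U)|²`
(`youngCoeff_ne_zero`).

For irreducibility (`isIrreducible_schurModule`), a submodule pulls back to a subspace of `V^{⊗d}`
stable under all derivations, hence by polarization under symmetrized products `∑ A_{s(1)} ⊗ ⋯ ⊗
A_{s(d)}` (`symMap_mem`). With rank-one `A_i`, a vector `x` in the subspace yields an element `a` of
the group algebra with `y·a` in the subspace for every `y`. Since `σaσ` is a multiple of `σ`,
nonzero for a good choice of `x` and coordinates, the submodule is everything. -/

namespace SchurForm

attribute [local instance 100] LieRing.ofAssociativeRing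

/-! ### Contravariant forms on irreducible modules -/

section ContravariantForms

variable {n : ℕ} {V : Type*} [AddCommGroup V] [Module ℂ V] [LieRingModule (sl n) V]
  [LieModule ℂ (sl n) V]

/-- Induction principle for the enveloping algebra. -/
theorem env_induction {C : Env n → Prop}
    (algebraMap : ∀ c : ℂ, C (algebraMap ℂ (Env n) c))
    (ι : ∀ x : sl n, C (UniversalEnvelopingAlgebra.ι ℂ x))
    (mul : ∀ a b, C a → C b → C (a * b)) (add : ∀ a b, C a → C b → C (a + b))
    (u : Env n) : C u := by
  let S : Subalgebra ℂ (Env n) :=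
    { carrier := {u | C u}
      mul_mem' := fun ha hb => mul _ _ ha hb
      add_mem' := fun ha hb => add _ _ ha hb
      algebraMap_mem' := algebraMap }
  let f : sl n →ₗ⁅ℂ⁆ S :=
    { toFun := fun x => ⟨UniversalEnvelopingAlgebra.ι ℂ x, ι x⟩
      map_add' := fun x y => Subtype.ext (map_add _ x y)
      map_smul' := fun c x => Subtype.ext (map_smul _ c x)
      map_lie' := fun {x y} => Subtype.ext (LieHom.map_lie _ x y) }
  -- The lift into `S` followed by inclusion fixes the generators, so it is the identity and `S` is
  -- everything.
  have h : S.val.comp (UniversalEnvelopingAlgebra.lift ℂ f) = AlgHom.id ℂ (Env n) := by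
    apply UniversalEnvelopingAlgebra.hom_ext
    ext x
    change S.val (UniversalEnvelopingAlgebra.lift ℂ f (UniversalEnvelopingAlgebra.ι ℂ x)) = _
    rw [UniversalEnvelopingAlgebra.lift_ι_apply]
    rfl
  have hu := AlgHom.congr_fun h u
  exact (show S.val (UniversalEnvelopingAlgebra.lift ℂ f u) = u from hu) ▸
    (UniversalEnvelopingAlgebra.lift ℂ f u).2

theorem tauEnv_algebraMap (c : ℂ) :
    tauEnv n (algebraMap ℂ (Env n) c) = algebraMap ℂ (Env n) c := by
  unfold tauEnv
  rw [AlgHom.commutes]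
  rfl

theorem tauEnv_one : tauEnv n 1 = 1 := by
  unfold tauEnv
  rw [map_one, MulOpposite.unop_one]

theorem tauEnv_ι (x : sl n) :
    tauEnv n (UniversalEnvelopingAlgebra.ι ℂ x) = UniversalEnvelopingAlgebra.ι ℂ (tau n x) := by
  unfold tauEnv
  rw [UniversalEnvelopingAlgebra.lift_ι_apply]
  rfl

theorem tauEnv_mul (a b : Env n) : tauEnv n (a * b) = tauEnv n b * tauEnv n a := by
  unfold tauEnv
  rw [map_mul, MulOpposite.unop_mul]

theorem tauEnv_add (a b : Env n) : tauEnv n (a + b) = tauEnv n a + tauEnv n b := by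
  unfold tauEnv
  rw [map_add, MulOpposite.unop_add]

theorem envAct_algebraMap (c : ℂ) (v : V) : envAct n (algebraMap ℂ (Env n) c) v = c • v := by
  unfold envAct
  rw [AlgHom.commutes]
  rfl

theorem envAct_one (v : V) : envAct n 1 v = v := by
  unfold envAct
  rw [map_one, Module.End.one_apply]

theorem envAct_ι (x : sl n) (v : V) : envAct n (UniversalEnvelopingAlgebra.ι ℂ x) v = ⁅x, v⁆ := by
  unfold envAct
  rw [UniversalEnvelopingAlgebra.lift_ι_apply]
  rfl

theorem envAct_mul (a b : Env n) (v : V) : envAct n (a * b) v = envAct n a (envAct n b v) := by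
  unfold envAct
  rw [map_mul, Module.End.mul_apply]

theorem envAct_add (a b : Env n) (v : V) : envAct n (a + b) v = envAct n a v + envAct n b v := by
  unfold envAct
  rw [map_add, LinearMap.add_apply]

/-- Passing to adjoints reverses products, and so does `τ`; the condition therefore propagates from
the generators to the whole enveloping algebra. -/
theorem isContravariant_iff (β : LinearMap.BilinForm ℂ V) :
    IsContravariant n β ↔ ∀ (x : sl n) (v w : V), β ⁅x, v⁆ w = β v ⁅tau n x, w⁆ := by
  refine ⟨fun h x v w => ?_, fun h u => ?_⟩
  · have := h (UniversalEnvelopingAlgebra.ι ℂ x) v w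
    rwa [tauEnv_ι, envAct_ι, envAct_ι] at this
  · induction u using env_induction with
    | algebraMap c =>
      intro v w
      rw [tauEnv_algebraMap, envAct_algebraMap, envAct_algebraMap, map_smul, map_smul,
        LinearMap.smul_apply]
    | ι x =>
      intro v w
      rw [tauEnv_ι, envAct_ι, envAct_ι, h]
    | mul a b ha hb =>
      intro v w
      rw [tauEnv_mul, envAct_mul, envAct_mul, ha, hb]
    | add a b ha hb =>
      intro v w
      rw [tauEnv_add, envAct_add, envAct_add, map_add, map_add, LinearMap.add_apply, ha, hb]

omit [LieModule ℂ (sl n) V] in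
/-- A submodule stable under `sl_{n+1}` of an irreducible module that contains a non-zero vector
is everything. -/
theorem mem_of_irreducible [h : LieModule.IsIrreducible ℂ (sl n) V] (N : Submodule ℂ V)
    (hN : ∀ (x : sl n), ∀ v ∈ N, ⁅x, v⁆ ∈ N) {v : V} (hv : v ∈ N) (hv0 : v ≠ 0) (w : V) :
    w ∈ N := by
  let N' : LieSubmodule ℂ (sl n) V := { N with lie_mem := fun {x m} hm => hN x m hm }
  rcases h.eq_bot_or_eq_top N' with e | e
  · exact absurd ((LieSubmodule.mem_bot v).1 (e ▸ (show v ∈ N' from hv))) hv0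
  · exact (show w ∈ N' from e ▸ LieSubmodule.mem_top w)

/-- Contravariance makes the left radical stable under the Lie algebra, so by irreducibility it is
zero or everything. -/
theorem IsContravariant.ker_eq_bot [LieModule.IsIrreducible ℂ (sl n) V]
    {β : LinearMap.BilinForm ℂ V} (hβ : IsContravariant n β) (h0 : β ≠ 0) :
    LinearMap.ker β = ⊥ := by
  rw [Submodule.eq_bot_iff]
  intro x hx
  by_contra hx0
  apply h0
  refine LinearMap.ext fun w => ?_
  refine mem_of_irreducible (n := n) (LinearMap.ker β) (fun y v hv => ?_) hx hx0 w
  rw [LinearMap.mem_ker] at hv ⊢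
  ext w
  rw [(isContravariant_iff β).1 hβ, hv]
  rfl

/-- On a finite-dimensional irreducible module, a non-zero contravariant form is unique up to a
scalar. -/
theorem IsContravariant.exists_eq_smul [FiniteDimensional ℂ V] [LieModule.IsIrreducible ℂ (sl n) V]
    {β F : LinearMap.BilinForm ℂ V} (hβ : IsContravariant n β) (h0 : β ≠ 0)
    (hF : IsContravariant n F) : ∃ c : ℂ, F = c • β := by
  have hinj : Function.Injective β := LinearMap.ker_eq_bot.1 (hβ.ker_eq_bot h0)
  let e : V ≃ₗ[ℂ] Module.Dual ℂ V :=
    LinearMap.linearEquivOfInjective β hinj Subspace.dual_finrank_eq.symm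
  have he : ∀ x, e x = β x := fun x => rfl
  -- Schur's lemma: `A = β⁻¹F` is equivariant because both forms are contravariant, so an eigenspace
  -- of it is a nonzero submodule.
  let A : Module.End ℂ V := e.symm.toLinearMap ∘ₗ F
  have hA : ∀ x, β (A x) = F x := fun x => by rw [← he]; exact e.apply_symm_apply _
  have hnt : Nontrivial V := by
    by_contra hs
    rw [not_nontrivial_iff_subsingleton] at hs
    exact h0 (LinearMap.ext fun x => by rw [Subsingleton.elim x 0, map_zero, map_zero])
  obtain ⟨c, hc⟩ := Module.End.exists_eigenvalue A
  obtain ⟨x, hx⟩ := hc.exists_hasEigenvector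
  refine ⟨c, LinearMap.ext fun w => ?_⟩
  rw [← hA, LinearMap.smul_apply, ← map_smul]
  congr 1
  refine Module.End.mem_eigenspace_iff.1 (mem_of_irreducible (n := n) (Module.End.eigenspace A c)
    (fun y v hv => ?_) hx.1 hx.2 w)
  rw [Module.End.mem_eigenspace_iff] at hv ⊢
  apply hinj
  ext w
  rw [hA, (isContravariant_iff F).1 hF, ← hA, hv, ← lie_smul, ← (isContravariant_iff β).1 hβ]

theorem IsContravariant.eq_of_apply_eq_one [FiniteDimensional ℂ V]
    [LieModule.IsIrreducible ℂ (sl n) V] {β F : LinearMap.BilinForm ℂ V} {vp : V}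
    (hβ : IsContravariant n β) (hF : IsContravariant n F) (h1 : β vp vp = 1) (h2 : F vp vp = 1) :
    F = β := by
  have h0 : β ≠ 0 := by
    rintro rfl
    simp at h1
  obtain ⟨c, rfl⟩ := hβ.exists_eq_smul h0 hF
  have hc : c = 1 := by simpa [h1] using h2
  rw [hc, one_smul]

theorem tau_of_mem_cartan (h : cartan n) : tau n (h : sl n) = h :=
  Subtype.ext (Matrix.IsDiag.isSymm h.2)

/-- Diagonal matrices are fixed by `τ`, hence self-adjoint for `β`; eigenvectors with different
eigenvalues are orthogonal. -/
theorem IsContravariant.apply_eq_zero_of_weight_ne {β : LinearMap.BilinForm ℂ V}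
    (hβ : IsContravariant n β) {μ ν : Module.Dual ℂ (cartan n)} (hne : μ ≠ ν) {v w : V}
    (hv : v ∈ weightSpace n V ν) (hw : w ∈ weightSpace n V μ) : β v w = 0 := by
  obtain ⟨h, hh⟩ : ∃ h, μ h ≠ ν h := by
    by_contra! hcon
    exact hne (LinearMap.ext hcon)
  have key := (isContravariant_iff β).1 hβ h v w
  rw [tau_of_mem_cartan, hv h, hw h, map_smul, map_smul, LinearMap.smul_apply, smul_eq_mul,
    smul_eq_mul] at key
  have : (μ h - ν h) * β v w = 0 := by rw [sub_mul, key, sub_self]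
  exact (mul_eq_zero.1 this).resolve_left (sub_ne_zero.2 hh)

/-- The isomorphism `φ` is `β` itself, bijective by nondegeneracy and equality of dimensions.
Orthogonality of weight spaces identifies `β vp` with `f⁺`. -/
theorem IsContravariant.isTheContravariantForm [FiniteDimensional ℂ V]
    [LieModule.IsIrreducible ℂ (sl n) V] {β : LinearMap.BilinForm ℂ V} {vp : V}
    {wt : Module.Dual ℂ (cartan n)} (hβ : IsContravariant n β) (hvp : vp ∈ weightSpace n V wt)
    (h1 : β vp vp = 1) : IsTheContravariantForm n wt vp β := by
  have h0 : β ≠ 0 := by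
    rintro rfl
    simp at h1
  have hinj : Function.Injective β := LinearMap.ker_eq_bot.1 (hβ.ker_eq_bot h0)
  have hequiv : ∀ (u : Env n) (x : V), β (envAct n u x) = twistedAct n u (β x) := fun u x =>
    LinearMap.ext fun y => hβ u x y
  refine ⟨β vp, LinearMap.linearEquivOfInjective β hinj Subspace.dual_finrank_eq.symm,
    fun c w hw => ?_, hequiv, fun u => hequiv u vp, fun x y => rfl⟩
  have hw0 : ⨆ (μ : Module.Dual ℂ (cartan n)) (_ : μ ≠ wt), weightSpace n V μ ≤
      LinearMap.ker (β vp) :=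
    iSup₂_le fun μ hμ x hx => hβ.apply_eq_zero_of_weight_ne hμ hvp hx
  rw [map_add, map_smul, h1, LinearMap.mem_ker.1 (hw0 hw), smul_eq_mul, mul_one, add_zero]

theorem IsTheContravariantForm.isContravariant {β : LinearMap.BilinForm ℂ V} {vp : V}
    {wt : Module.Dual ℂ (cartan n)} (h : IsTheContravariantForm n wt vp β) :
    IsContravariant n β := by
  obtain ⟨fp, φ, -, hφ, -, hβ⟩ := h
  intro u x y
  rw [hβ, hβ, hφ]
  rfl

theorem IsTheContravariantForm.apply_self {β : LinearMap.BilinForm ℂ V} {vp : V}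
    {wt : Module.Dual ℂ (cartan n)} (h : IsTheContravariantForm n wt vp β) : β vp vp = 1 := by
  obtain ⟨fp, φ, hfp, -, hφ, hβ⟩ := h
  have h1 : φ vp = fp := by
    have := hφ 1
    rw [envAct_one] at this
    rw [this]
    unfold twistedAct
    ext y
    rw [LinearMap.comp_apply, tauEnv_one, envAct_one]
  have h2 := hfp 1 0 (Submodule.zero_mem _)
  rw [one_smul, add_zero] at h2
  rw [hβ, h1, h2]

end ContravariantForms

/-! ### The natural module and the dot product -/

section Natural

/-- The bilinear form on the natural module with orthonormal basis `a_1, …, a_{n+1}`. -/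
noncomputable def dotForm (n : ℕ) : LinearMap.BilinForm ℂ (NatMod n) := dotProductBilin ℂ ℂ

theorem dotForm_apply (n : ℕ) (v w : NatMod n) : dotForm n v w = ∑ j, v j * w j := rfl

theorem natMod_lie (n : ℕ) (x : sl n) (v : NatMod n) :
    ⁅x, v⁆ = (x : Matrix (Fin (n + 1)) (Fin (n + 1)) ℂ).mulVec v := rfl

theorem dotForm_mulVec (n : ℕ) (x : Matrix (Fin (n + 1)) (Fin (n + 1)) ℂ) (v w : NatMod n) :
    dotForm n (x.mulVec v) w = dotForm n v (x.transpose.mulVec w) := by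
  change dotProduct (x.mulVec v) w = dotProduct v (x.transpose.mulVec w)
  rw [dotProduct_comm, Matrix.dotProduct_mulVec, Matrix.mulVec_transpose, dotProduct_comm]

theorem isContravariant_dotForm (n : ℕ) : IsContravariant n (dotForm n) :=
  (isContravariant_iff _).2 fun x v w => dotForm_mulVec n x v w

theorem basisVec_eq_single (n : ℕ) (j : Fin (n + 1)) : basisVec n j = Pi.single j 1 := by
  ext i
  simp [basisVec, Pi.single_apply, Fin.ext_iff]

theorem dotForm_basisVec (n : ℕ) {i j : ℕ} (hi : i ≤ n) :
    dotForm n (basisVec n i) (basisVec n j) = if i = j then 1 else 0 := by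
  rw [dotForm_apply, Finset.sum_eq_single (⟨i, Nat.lt_succ_of_le hi⟩ : Fin (n + 1))]
  · simp [basisVec]
  · intro k _ hk
    have : (k : ℕ) ≠ i := fun e => hk (Fin.ext e)
    simp [basisVec, this]
  · simp

/-- Every matrix is a traceless matrix plus a scalar matrix. -/
theorem exists_sl_add_scalar (n : ℕ) (A : Matrix (Fin (n + 1)) (Fin (n + 1)) ℂ) :
    ∃ (x : sl n) (c : ℂ), A = x + c • (1 : Matrix (Fin (n + 1)) (Fin (n + 1)) ℂ) := by
  refine ⟨⟨A - (A.trace / (n + 1)) • 1, ?_⟩, A.trace / (n + 1), by simp⟩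
  change Matrix.trace (A - (A.trace / (n + 1)) • (1 : Matrix (Fin (n + 1)) (Fin (n + 1)) ℂ)) = 0
  have : (n : ℂ) + 1 ≠ 0 := Nat.cast_add_one_ne_zero n
  rw [Matrix.trace_sub, Matrix.trace_smul, Matrix.trace_one, Fintype.card_fin]
  push_cast
  rw [smul_eq_mul, div_mul_cancel₀ _ this, sub_self]

/-- Scalars preserve every subspace, so a submodule is stable under all matrices, and a rank-one
matrix carries a given nonzero vector to any vector. -/
theorem isIrreducible_natMod (n : ℕ) : LieModule.IsIrreducible ℂ (sl n) (NatMod n) := by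
  refine LieModule.IsIrreducible.mk fun N hN => ?_
  have hmat : ∀ (A : Matrix (Fin (n + 1)) (Fin (n + 1)) ℂ), ∀ v ∈ N, A.mulVec v ∈ N := by
    intro A v hv
    obtain ⟨x, c, rfl⟩ := exists_sl_add_scalar n A
    rw [Matrix.add_mulVec, Matrix.smul_mulVec, Matrix.one_mulVec]
    exact N.add_mem (N.lie_mem (x := x) hv) (N.smul_mem c hv)
  obtain ⟨v, hv, hv0⟩ : ∃ v ∈ N, v ≠ 0 := by
    by_contra! hcon
    exact hN ((LieSubmodule.eq_bot_iff N).2 hcon)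
  obtain ⟨j, hj⟩ := Function.ne_iff.1 hv0
  rw [eq_top_iff]
  intro w _
  have : (Matrix.vecMulVec w (Pi.single j (v j)⁻¹)).mulVec v = w := by
    rw [Matrix.vecMulVec_mulVec]
    simp [inv_mul_cancel₀ hj]
  exact this ▸ hmat _ v hv

instance (n : ℕ) : LieModule.IsIrreducible ℂ (sl n) (NatMod n) := isIrreducible_natMod n

/-- The action of a diagonal matrix on a basis vector. -/
theorem isDiag_mulVec_basisVec {n : ℕ} {h : Matrix (Fin (n + 1)) (Fin (n + 1)) ℂ} (hh : h.IsDiag)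
    (j : Fin (n + 1)) : h.mulVec (basisVec n j) = h j j • basisVec n j := by
  rw [basisVec_eq_single]
  ext i
  rw [Matrix.mulVec_single_one]
  by_cases hij : i = j
  · subst hij; simp
  · simp [hij, hh hij]

theorem basisVec_zero_mem_weightSpace (n : ℕ) :
    basisVec n 0 ∈ weightSpace n (NatMod n) (firstWeight n) := by
  intro h
  rw [natMod_lie]
  refine (isDiag_mulVec_basisVec h.2 0).trans ?_
  congr 1
  simp [firstWeight, diagWeight]

theorem isTheContravariantForm_dotForm (n : ℕ) :
    IsTheContravariantForm n (firstWeight n) (basisVec n 0) (dotForm n) :=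
  (isContravariant_dotForm n).isTheContravariantForm (basisVec_zero_mem_weightSpace n)
    (by rw [dotForm_basisVec n (Nat.zero_le n), if_pos rfl])

theorem IsTheContravariantForm.eq_dotForm {n : ℕ} {β : LinearMap.BilinForm ℂ (NatMod n)}
    (h : IsTheContravariantForm n (firstWeight n) (basisVec n 0) β) : β = dotForm n :=
  (isContravariant_dotForm n).eq_of_apply_eq_one h.isContravariant
    (isTheContravariantForm_dotForm n).apply_self h.apply_self

end Natural

/-! ### Column-injective fillings and factorization of permutations -/

section Combinatorics

variable {lam : YoungDiagram} {d : ℕ} (U : lam.cells ≃ Fin d)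

theorem eq_of_rowOf_eq_of_colOf_eq {i j : Fin d} (hr : rowOf U i = rowOf U j)
    (hc : colOf U i = colOf U j) : i = j :=
  U.symm.injective (Subtype.ext (Prod.ext hr hc))

theorem exists_box {r c : ℕ} (h : r < lam.colLen c) :
    ∃ i, rowOf U i = r ∧ colOf U i = c := by
  refine ⟨U ⟨(r, c), YoungDiagram.mem_iff_lt_colLen.2 h⟩, ?_, ?_⟩ <;> simp [rowOf, colOf]

theorem rowOf_lt_colLen (i : Fin d) : rowOf U i < lam.colLen (colOf U i) :=
  YoungDiagram.mem_iff_lt_colLen.1 (U.symm i).2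

theorem colOf_lt_rowLen (i : Fin d) : colOf U i < lam.rowLen (rowOf U i) :=
  YoungDiagram.mem_iff_lt_rowLen.1 (U.symm i).2

theorem card_rowOf_eq (r : ℕ) :
    (Finset.univ.filter fun i => rowOf U i = r).card = lam.rowLen r := by
  rw [← Finset.card_range (lam.rowLen r)]
  refine Finset.card_bij (fun i _ => colOf U i) (fun i hi => ?_) (fun i hi j hj h => ?_)
    (fun c hc => ?_)
  · rw [Finset.mem_filter] at hi
    rw [Finset.mem_range, ← hi.2]
    exact colOf_lt_rowLen U i
  · rw [Finset.mem_filter] at hi hj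
    exact eq_of_rowOf_eq_of_colOf_eq U (hi.2.trans hj.2.symm) h
  · rw [Finset.mem_range, ← YoungDiagram.mem_iff_lt_rowLen, YoungDiagram.mem_iff_lt_colLen] at hc
    obtain ⟨i, hi, hi'⟩ := exists_box U hc
    exact ⟨i, by simp [hi], hi'⟩

theorem eq_one_of_mem_rowGroup_of_mem_colGroup {g : Equiv.Perm (Fin d)} (hr : g ∈ rowGroup U)
    (hc : g ∈ colGroup U) : g = 1 :=
  Equiv.ext fun i => eq_of_rowOf_eq_of_colOf_eq U (hr i) (hc i)

/-- A filling whose entries in each column are distinct has at most as many entries `< k` in a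
column as the filling by row indices. -/
theorem card_filter_lt_le (S : Fin d → ℕ)
    (hS : ∀ i j, colOf U i = colOf U j → S i = S j → i = j) (k c : ℕ) :
    (Finset.univ.filter fun i => S i < k ∧ colOf U i = c).card ≤
      (Finset.univ.filter fun i => rowOf U i < k ∧ colOf U i = c).card := by
  -- In a column with at least `k` boxes the row filling uses every value below `k` once, the most
  -- that distinct entries allow; in a shorter column it already counts all boxes.
  rcases le_or_gt k (lam.colLen c) with hk | hk
  · refine le_trans (b := (Finset.range k).card) ?_ ?_
    · refine Finset.card_le_card_of_injOn S (fun i hi => ?_) (fun i hi j hj h => ?_)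
      · simp only [Finset.coe_filter, Set.mem_ofPred_eq] at hi
        simpa using hi.2.1
      · simp only [Finset.coe_filter, Set.mem_ofPred_eq] at hi hj
        exact hS i j (hi.2.2.trans hj.2.2.symm) h
    · refine Finset.card_le_card_of_surjOn (rowOf U) fun r hr => ?_
      rw [Finset.mem_coe, Finset.mem_range] at hr
      obtain ⟨i, hi, hi'⟩ := exists_box U (hr.trans_le hk)
      exact ⟨i, by simp [hi, hi', hr], hi⟩
  · refine Finset.card_le_card fun i hi => ?_
    rw [Finset.mem_filter] at hi ⊢
    refine ⟨hi.1, ?_, hi.2.2⟩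
    have := rowOf_lt_colLen U i
    rw [hi.2.2] at this
    exact this.trans hk

/-- A rearrangement of the filling by row indices whose entries in each column are distinct
has only entries smaller than `colLen c` in column `c`. -/
theorem lt_colLen_of_col_injective (S : Fin d → ℕ) (g : Equiv.Perm (Fin d))
    (hg : ∀ i, S (g i) = rowOf U i)
    (hS : ∀ i j, colOf U i = colOf U j → S i = S j → i = j) (i : Fin d) :
    S i < lam.colLen (colOf U i) := by
  set k := lam.colLen (colOf U i) with hk
  have htot : (Finset.univ.filter fun i => S i < k).card =
      (Finset.univ.filter fun i => rowOf U i < k).card := by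
    symm
    refine Finset.card_bij (fun i _ => g i) (fun i hi => ?_) (fun i _ j _ h => g.injective h)
      (fun j hj => ⟨g.symm j, ?_, g.apply_symm_apply j⟩)
    · simpa [hg] using hi
    · have h := hg (g.symm j)
      rw [Equiv.apply_symm_apply] at h
      simpa [← h] using hj
  have hmaps : ∀ p : Fin d → Prop, ∀ [DecidablePred p],
      (Finset.univ.filter p).card = ∑ c ∈ Finset.univ.image (colOf U),
        (Finset.univ.filter fun i => p i ∧ colOf U i = c).card := by
    intro p _
    rw [Finset.card_eq_sum_card_fiberwise (f := colOf U) (t := Finset.univ.image (colOf U))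
      (fun i _ => by simp)]
    refine Finset.sum_congr rfl fun c _ => ?_
    rw [Finset.filter_filter]
  -- The two fillings have equal totals of entries below `k`, so the columnwise inequalities are all
  -- equalities. In the column of `i`, whose length is `k`, every box is then counted.
  rw [hmaps, hmaps, Finset.sum_eq_sum_iff_of_le (fun c _ => card_filter_lt_le U S hS k c)] at htot
  have hcol := htot (colOf U i) (Finset.mem_image_of_mem _ (Finset.mem_univ i))
  have hB : (Finset.univ.filter fun j => rowOf U j < k ∧ colOf U j = colOf U i) =
      Finset.univ.filter fun j => colOf U j = colOf U i := by
    refine Finset.filter_congr fun j _ => ⟨fun h => h.2, fun h => ⟨?_, h⟩⟩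
    rw [hk, ← h]
    exact rowOf_lt_colLen U j
  rw [hB] at hcol
  have hA := Finset.eq_of_subset_of_card_le
    (Finset.monotone_filter_right Finset.univ (fun j _ h => h.2)) hcol.ge
  have hi : i ∈ Finset.univ.filter fun j => S j < k ∧ colOf U j = colOf U i := by
    rw [hA]
    simp
  exact (Finset.mem_filter.1 hi).2.1

/-- If `g` sends boxes in the same row to boxes in different columns, then `g` is the product of
an element of the column group and an element of the row group. -/
theorem exists_col_mul_row (g : Equiv.Perm (Fin d))
    (h : ∀ i j, i ≠ j → rowOf U i = rowOf U j → colOf U (g i) ≠ colOf U (g j)) :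
    ∃ c ∈ colGroup U, ∃ r ∈ rowGroup U, g = c * r := by
  let S : Fin d → ℕ := fun i => rowOf U (g.symm i)
  have hS : ∀ i j, colOf U i = colOf U j → S i = S j → i = j := by
    intro i j hc hs
    by_contra hij
    refine h (g.symm i) (g.symm j) (fun e => hij (g.symm.injective e)) hs ?_
    rwa [Equiv.apply_symm_apply, Equiv.apply_symm_apply]
  have hlt := lt_colLen_of_col_injective U S g (fun i => by simp [S]) hS
  choose f hf hf' using fun i => exists_box U (hlt i)
  have hinj : Function.Injective f := fun i j e =>
    hS i j (by rw [← hf' i, ← hf' j, e]) (by rw [← hf i, ← hf j, e])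
  -- `c` moves each box within its column to the row prescribed by `S`, which undoes the effect of
  -- `g` on rows: `c * g` lies in the row group.
  let c : Equiv.Perm (Fin d) := Equiv.ofBijective f (Finite.injective_iff_bijective.1 hinj)
  refine ⟨c⁻¹, (colGroup U).inv_mem hf', c * g, fun i => ?_, by rw [inv_mul_cancel_left]⟩
  exact (hf (g i)).trans (by simp [S])

end Combinatorics

/-! ### The Young symmetrizer and its quasi-idempotence -/

section Symmetrizer

variable {lam : YoungDiagram} {d : ℕ} (U : lam.cells ≃ Fin d)

theorem sgn_one : sgn (1 : Equiv.Perm (Fin d)) = 1 := by simp [sgn]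

theorem sgn_mul (g h : Equiv.Perm (Fin d)) : sgn (g * h) = sgn g * sgn h := by simp [sgn]

theorem sgn_mul_self (g : Equiv.Perm (Fin d)) : sgn g * sgn g = 1 := by
  unfold sgn
  rw [← Int.cast_mul, Int.units_coe_mul_self, Int.cast_one]

theorem sgn_inv (g : Equiv.Perm (Fin d)) : sgn g⁻¹ = sgn g := by simp [sgn]

theorem sgn_swap {i j : Fin d} (h : i ≠ j) : sgn (Equiv.swap i j) = -1 := by
  simp [sgn, Equiv.Perm.sign_swap h]

theorem single_mul_rowSum {r : Equiv.Perm (Fin d)} (hr : r ∈ rowGroup U) :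
    MonoidAlgebra.single r 1 * rowSum U = rowSum U := by
  unfold rowSum
  rw [Finset.mul_sum]
  refine Fintype.sum_equiv (Equiv.mulLeft (⟨r, hr⟩ : rowGroup U)) _ _ fun x => ?_
  rw [MonoidAlgebra.single_mul_single, one_mul]
  rfl

theorem single_mul_colSum {c : Equiv.Perm (Fin d)} (hc : c ∈ colGroup U) :
    MonoidAlgebra.single c 1 * colSum U = sgn c • colSum U := by
  unfold colSum
  rw [Finset.mul_sum, Finset.smul_sum]
  refine Fintype.sum_equiv (Equiv.mulLeft (⟨c, hc⟩ : colGroup U)) _ _ fun x => ?_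
  rw [MonoidAlgebra.single_mul_single, one_mul, MonoidAlgebra.smul_single, smul_eq_mul]
  change MonoidAlgebra.single (c * (x : Equiv.Perm (Fin d))) _ =
    MonoidAlgebra.single (c * (x : Equiv.Perm (Fin d))) (sgn c * sgn (c * (x : Equiv.Perm (Fin d))))
  rw [sgn_mul, ← mul_assoc, sgn_mul_self, one_mul]

theorem colSum_mul_single {c : Equiv.Perm (Fin d)} (hc : c ∈ colGroup U) :
    colSum U * MonoidAlgebra.single c 1 = sgn c • colSum U := by
  unfold colSum
  rw [Finset.sum_mul, Finset.smul_sum]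
  refine Fintype.sum_equiv (Equiv.mulRight (⟨c, hc⟩ : colGroup U)) _ _ fun x => ?_
  rw [MonoidAlgebra.single_mul_single, mul_one, MonoidAlgebra.smul_single, smul_eq_mul]
  change MonoidAlgebra.single ((x : Equiv.Perm (Fin d)) * c) _ =
    MonoidAlgebra.single ((x : Equiv.Perm (Fin d)) * c) (sgn c * sgn ((x : Equiv.Perm (Fin d)) * c))
  rw [sgn_mul, mul_left_comm, sgn_mul_self, mul_one]

theorem colSum_mul_colSum : colSum U * colSum U = (Fintype.card (colGroup U) : ℂ) • colSum U := by
  conv_lhs => lhs; unfold colSum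
  rw [Finset.sum_mul, Nat.cast_smul_eq_nsmul, ← Finset.card_univ, ← Finset.sum_const]
  refine Finset.sum_congr rfl fun c _ => ?_
  have h : (MonoidAlgebra.single (c : Equiv.Perm (Fin d)) (sgn (c : Equiv.Perm (Fin d))) :
      GroupAlg d) = sgn (c : Equiv.Perm (Fin d)) •
        (MonoidAlgebra.single (c : Equiv.Perm (Fin d)) 1 : GroupAlg d) := by
    rw [MonoidAlgebra.smul_single, smul_eq_mul, mul_one]
  rw [h, smul_mul_assoc, single_mul_colSum U c.2, smul_smul, sgn_mul_self, one_smul]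

theorem youngSym_eq_sum : youngSym U = ∑ c : colGroup U, ∑ r : rowGroup U,
    MonoidAlgebra.single ((c : Equiv.Perm (Fin d)) * r) (sgn (c : Equiv.Perm (Fin d))) := by
  unfold youngSym colSum rowSum
  rw [Finset.sum_mul_sum]
  simp only [MonoidAlgebra.single_mul_single, mul_one]

/-- The row and column groups meet trivially, so only the pair `(1, 1)` has product `1`. -/
theorem coeff_youngSym_one : (youngSym U).coeff 1 = 1 := by
  classical
  rw [youngSym_eq_sum, MonoidAlgebra.coeff_sum, Finsupp.finsetSum_apply,
    Finset.sum_eq_single (1 : colGroup U)]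
  · rw [MonoidAlgebra.coeff_sum, Finsupp.finsetSum_apply, Finset.sum_eq_single (1 : rowGroup U)]
    · simp [sgn_one]
    · intro r _ hr
      simp [hr]
    · simp
  · intro c _ hc
    rw [MonoidAlgebra.coeff_sum, Finsupp.finsetSum_apply]
    refine Finset.sum_eq_zero fun r _ => ?_
    rw [MonoidAlgebra.coeff_single, Finsupp.single_apply, if_neg]
    intro h
    have hcr : (c : Equiv.Perm (Fin d)) = (r : Equiv.Perm (Fin d))⁻¹ := eq_inv_of_mul_eq_one_left h
    exact hc (Subtype.ext (eq_one_of_mem_rowGroup_of_mem_colGroup U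
      (hcr ▸ (rowGroup U).inv_mem r.2) c.2))
  · simp

/-- Either `g` factors as column times row element and both factors are absorbed up to sign, or `g`
sends two boxes of one row into one column. In the latter case `g (i j) = (g i g j) g`: the
transposition is absorbed with sign `1` on the right and `-1` on the left, so the product is its own
negative. -/
theorem colSum_mul_single_mul_rowSum (g : Equiv.Perm (Fin d)) :
    ∃ c : ℂ, colSum U * MonoidAlgebra.single g 1 * rowSum U = c • youngSym U := by
  by_cases h : ∀ i j, i ≠ j → rowOf U i = rowOf U j → colOf U (g i) ≠ colOf U (g j)
  · obtain ⟨c, hc, r, hr, rfl⟩ := exists_col_mul_row U g h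
    refine ⟨sgn c, ?_⟩
    rw [← mul_one (1 : ℂ), ← MonoidAlgebra.single_mul_single, ← mul_assoc,
      colSum_mul_single U hc, mul_assoc, single_mul_rowSum U hr, smul_mul_assoc]
    rfl
  · push Not at h
    obtain ⟨i, j, hij, hrow, hcol⟩ := h
    refine ⟨0, ?_⟩
    have hr : Equiv.swap i j ∈ rowGroup U := by
      intro k
      rw [Equiv.swap_apply_def]
      split_ifs with h1 h2
      · rw [h1, hrow]
      · rw [h2, hrow]
      · rfl
    have hc : Equiv.swap (g i) (g j) ∈ colGroup U := by
      intro k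
      rw [Equiv.swap_apply_def]
      split_ifs with h1 h2
      · rw [h1, hcol]
      · rw [h2, hcol]
      · rfl
    have key : colSum U * MonoidAlgebra.single g 1 * rowSum U =
        -(colSum U * MonoidAlgebra.single g 1 * rowSum U) := by
      conv_lhs => rw [← single_mul_rowSum U hr, ← mul_assoc, mul_assoc (colSum U),
        MonoidAlgebra.single_mul_single, Equiv.mul_swap_eq_swap_mul,
        ← MonoidAlgebra.single_mul_single, ← mul_assoc, colSum_mul_single U hc,
        sgn_swap (fun e => hij (g.injective e))]
      rw [neg_one_smul, neg_mul, neg_mul]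
    rw [zero_smul]
    have h2 : (2 : ℂ) • (colSum U * MonoidAlgebra.single g 1 * rowSum U) = 0 := by
      rw [two_smul]
      nth_rewrite 1 [key]
      exact neg_add_cancel _
    exact (smul_eq_zero.1 h2).resolve_left two_ne_zero

/-- Von Neumann's lemma. -/
theorem colSum_mul_mul_rowSum (x : GroupAlg d) :
    colSum U * x * rowSum U = (colSum U * x * rowSum U).coeff 1 • youngSym U := by
  have h : ∃ c : ℂ, colSum U * x * rowSum U = c • youngSym U := by
    induction x using MonoidAlgebra.induction_on with
    | of g => exact colSum_mul_single_mul_rowSum U g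
    | add x y hx hy =>
      obtain ⟨a, ha⟩ := hx
      obtain ⟨b, hb⟩ := hy
      exact ⟨a + b, by rw [mul_add, add_mul, ha, hb, add_smul]⟩
    | smul r x hx =>
      obtain ⟨a, ha⟩ := hx
      exact ⟨r * a, by rw [mul_smul_comm, smul_mul_assoc, ha, smul_smul]⟩
  obtain ⟨c, hc⟩ := h
  -- The scalar is read off at the identity, where `σ_U` has coefficient `1`.
  rw [hc, MonoidAlgebra.coeff_smul, Finsupp.smul_apply, coeff_youngSym_one, smul_eq_mul, mul_one]

theorem youngSym_mul_mul_youngSym (x : GroupAlg d) :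
    youngSym U * x * youngSym U = (youngSym U * x * youngSym U).coeff 1 • youngSym U := by
  have h := colSum_mul_mul_rowSum U (rowSum U * x * colSum U)
  have e : youngSym U * x * youngSym U =
      colSum U * (rowSum U * x * colSum U) * rowSum U := by
    simp only [youngSym, mul_assoc]
  rw [e]
  exact h

/-- The coefficient of the identity in the square of the Young symmetrizer. -/
noncomputable def youngCoeff : ℂ := (youngSym U * youngSym U).coeff 1

theorem youngSym_mul_youngSym : youngSym U * youngSym U = youngCoeff U • youngSym U := by
  have h := youngSym_mul_mul_youngSym U 1
  rwa [mul_one] at h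

/-- The linear extension of inversion, as an anti-automorphism of the group algebra. -/
noncomputable def invHom (d : ℕ) : GroupAlg d →ₐ[ℂ] (GroupAlg d)ᵐᵒᵖ :=
  MonoidAlgebra.lift ℂ _ _
    { toFun := fun g => MulOpposite.op (MonoidAlgebra.single g⁻¹ 1)
      map_one' := by rw [inv_one]; rfl
      map_mul' := fun g h => by
        rw [← MulOpposite.op_mul, MonoidAlgebra.single_mul_single, mul_inv_rev, one_mul] }

/-- The linear extension of inversion. -/
noncomputable def invAlg (x : GroupAlg d) : GroupAlg d := MulOpposite.unop (invHom d x)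

theorem invAlg_single (g : Equiv.Perm (Fin d)) (c : ℂ) :
    invAlg (MonoidAlgebra.single g c) = MonoidAlgebra.single g⁻¹ c := by
  simp [invAlg, invHom, MonoidAlgebra.lift_single]

theorem invAlg_mul (x y : GroupAlg d) : invAlg (x * y) = invAlg y * invAlg x := by
  simp [invAlg]

theorem invAlg_add (x y : GroupAlg d) : invAlg (x + y) = invAlg x + invAlg y := by
  simp [invAlg]

theorem invAlg_smul (c : ℂ) (x : GroupAlg d) : invAlg (c • x) = c • invAlg x := by
  simp [invAlg]

theorem invAlg_sum {ι : Type*} (s : Finset ι) (f : ι → GroupAlg d) :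
    invAlg (∑ i ∈ s, f i) = ∑ i ∈ s, invAlg (f i) := by
  simp [invAlg]

theorem coeff_invAlg (x : GroupAlg d) (g : Equiv.Perm (Fin d)) :
    (invAlg x).coeff g = x.coeff g⁻¹ := by
  classical
  induction x using MonoidAlgebra.induction_on with
  | of h =>
    rw [MonoidAlgebra.of_apply, invAlg_single, MonoidAlgebra.coeff_single,
      MonoidAlgebra.coeff_single, Finsupp.single_apply, Finsupp.single_apply]
    simp only [inv_eq_iff_eq_inv]
  | add x y hx hy => simp [invAlg_add, hx, hy]
  | smul r x hx => simp [invAlg_smul, hx]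

theorem invAlg_rowSum : invAlg (rowSum U) = rowSum U := by
  unfold rowSum
  rw [invAlg_sum]
  refine Fintype.sum_equiv (Equiv.inv _) _ _ fun x => ?_
  rw [invAlg_single]
  rfl

theorem invAlg_colSum : invAlg (colSum U) = colSum U := by
  unfold colSum
  rw [invAlg_sum]
  refine Fintype.sum_equiv (Equiv.inv _) _ _ fun x => ?_
  rw [invAlg_single, ← sgn_inv]
  rfl

/-- The integral group ring inside the complex group algebra. -/
noncomputable def intGroupRing (d : ℕ) : Subring (GroupAlg d) :=
  (MonoidAlgebra.mapRingHom (Equiv.Perm (Fin d)) (Int.castRingHom ℂ)).range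

theorem single_mem_intGroupRing (g : Equiv.Perm (Fin d)) (m : ℤ) :
    MonoidAlgebra.single g (m : ℂ) ∈ intGroupRing d :=
  ⟨MonoidAlgebra.single g m, by simp⟩

theorem exists_int_coeff {x : GroupAlg d} (hx : x ∈ intGroupRing d) (g : Equiv.Perm (Fin d)) :
    ∃ m : ℤ, x.coeff g = m := by
  obtain ⟨y, rfl⟩ := hx
  exact ⟨y.coeff g, by simp⟩

theorem rowSum_mem_intGroupRing : rowSum U ∈ intGroupRing d :=
  Subring.sum_mem _ fun r _ => by
    simpa using single_mem_intGroupRing (r : Equiv.Perm (Fin d)) 1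

theorem colSum_mem_intGroupRing : colSum U ∈ intGroupRing d :=
  Subring.sum_mem _ fun _ _ => single_mem_intGroupRing _ _

theorem exists_int_youngCoeff : ∃ m : ℤ, youngCoeff U = m := by
  have h : youngSym U ∈ intGroupRing d :=
    Subring.mul_mem _ (colSum_mem_intGroupRing U) (rowSum_mem_intGroupRing U)
  exact exists_int_coeff (Subring.mul_mem _ h h) 1

theorem coeff_mul_one (x y : GroupAlg d) :
    (x * y).coeff 1 = ∑ g : Equiv.Perm (Fin d), x.coeff g * y.coeff g⁻¹ := by
  rw [MonoidAlgebra.coeff_mul_apply_left, Finsupp.sum_fintype]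
  · simp
  · simp

/-- The identity coefficient is a trace; this cyclicity evaluates the scalars produced by von
Neumann's lemma. -/
theorem coeff_mul_one_comm (x y : GroupAlg d) : (x * y).coeff 1 = (y * x).coeff 1 := by
  rw [coeff_mul_one, coeff_mul_one]
  refine Fintype.sum_equiv (Equiv.inv _) _ _ fun g => ?_
  simp [mul_comm]

/-- The element `γ_U ρ_U γ_U`. -/
noncomputable def colRowCol : GroupAlg d := colSum U * rowSum U * colSum U

theorem coeff_colRowCol_one : (colRowCol U).coeff 1 = Fintype.card (colGroup U) := by
  rw [colRowCol, coeff_mul_one_comm, ← mul_assoc, colSum_mul_colSum, smul_mul_assoc,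
    MonoidAlgebra.coeff_smul, Finsupp.smul_apply, ← youngSym, coeff_youngSym_one, smul_eq_mul,
    mul_one]

theorem invAlg_colRowCol : invAlg (colRowCol U) = colRowCol U := by
  simp only [colRowCol, invAlg_mul, invAlg_colSum, invAlg_rowSum, mul_assoc]

/-- If `σ² = 0`, then `x = γργ` satisfies `x² = |C(U)| σ²γ = 0`. As `x` is fixed by inversion and
has integer coefficients, the identity coefficient of `x²` is the sum of their squares, so `x`
vanishes; yet its identity coefficient is `|C(U)|`. -/
theorem youngCoeff_ne_zero : youngCoeff U ≠ 0 := by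
  intro h0
  have hsq : youngSym U * youngSym U = 0 := by rw [youngSym_mul_youngSym, h0, zero_smul]
  have hx : colRowCol U * colRowCol U = 0 := by
    have : colRowCol U * colRowCol U = youngSym U * (colSum U * colSum U) * rowSum U * colSum U := by
      simp only [colRowCol, youngSym, mul_assoc]
    rw [this, colSum_mul_colSum, mul_smul_comm, smul_mul_assoc, smul_mul_assoc,
      mul_assoc (youngSym U) (colSum U), ← youngSym, hsq, zero_mul, smul_zero]
  have hint : colRowCol U ∈ intGroupRing d :=
    Subring.mul_mem _ (Subring.mul_mem _ (colSum_mem_intGroupRing U) (rowSum_mem_intGroupRing U))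
      (colSum_mem_intGroupRing U)
  choose m hm using exists_int_coeff hint
  have hsum : ∑ g : Equiv.Perm (Fin d), m g * m g = 0 := by
    have h1 := coeff_mul_one (colRowCol U) (colRowCol U)
    rw [hx] at h1
    have h2 : ∀ g, (colRowCol U).coeff g⁻¹ = m g := fun g => by
      rw [← coeff_invAlg, invAlg_colRowCol, hm]
    simp only [h2] at h1
    simp only [hm] at h1
    have h3 : ((∑ g : Equiv.Perm (Fin d), m g * m g : ℤ) : ℂ) = 0 := by
      push_cast
      exact h1.symm
    exact_mod_cast h3
  have h1 := (Finset.sum_eq_zero_iff_of_nonneg fun g _ => mul_self_nonneg (m g)).1 hsum 1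
    (Finset.mem_univ 1)
  have h2 := hm 1
  rw [mul_self_eq_zero.1 h1, coeff_colRowCol_one, Int.cast_zero] at h2
  exact Fintype.card_ne_zero (Nat.cast_eq_zero.1 h2)

end Symmetrizer

/-! ### The right action of the group algebra on tensors -/

section PermutationAction

variable {d : ℕ} {V : Type*} [AddCommGroup V] [Module ℂ V]

theorem tensor_ext {E : Type*} [AddCommGroup E] [Module ℂ E] {F G : TPow d V →ₗ[ℂ] E}
    (h : ∀ v : Fin d → V, F (PiTensorProduct.tprod ℂ v) = G (PiTensorProduct.tprod ℂ v)) :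
    F = G :=
  PiTensorProduct.ext (MultilinearMap.ext h)

theorem tensor_ext₂ {F G : LinearMap.BilinForm ℂ (TPow d V)}
    (h : ∀ v u : Fin d → V, F (PiTensorProduct.tprod ℂ v) (PiTensorProduct.tprod ℂ u) =
      G (PiTensorProduct.tprod ℂ v) (PiTensorProduct.tprod ℂ u)) : F = G :=
  tensor_ext fun v => tensor_ext fun u => h v u

theorem permAct_one : permAct V (1 : Equiv.Perm (Fin d)) = LinearMap.id :=
  tensor_ext fun v => by rw [permAct_tprod]; rfl

theorem permAct_mul (s t : Equiv.Perm (Fin d)) :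
    permAct V (s * t) = permAct V t ∘ₗ permAct V s :=
  tensor_ext fun v => by rw [LinearMap.comp_apply, permAct_tprod, permAct_tprod, permAct_tprod]; rfl

variable (V) in
/-- The right action of the group algebra on `V^{⊗ d}`, as an algebra homomorphism. -/
noncomputable def algHom (d : ℕ) : GroupAlg d →ₐ[ℂ] (Module.End ℂ (TPow d V))ᵐᵒᵖ :=
  MonoidAlgebra.lift ℂ _ _
    { toFun := fun s => MulOpposite.op (permAct V s)
      map_one' := by rw [permAct_one]; rfl
      map_mul' := fun s t => by rw [permAct_mul]; rfl }

variable (V) in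
/-- The right action `w ↦ w · a` of the group algebra on `V^{⊗ d}`. -/
noncomputable def algAct (a : GroupAlg d) : Module.End ℂ (TPow d V) :=
  MulOpposite.unop (algHom V d a)

theorem algAct_single (s : Equiv.Perm (Fin d)) (c : ℂ) :
    algAct V (MonoidAlgebra.single s c) = c • permAct V s := by
  simp [algAct, algHom, MonoidAlgebra.lift_single]

theorem algAct_add (a b : GroupAlg d) : algAct V (a + b) = algAct V a + algAct V b := by
  simp [algAct]

theorem algAct_smul (c : ℂ) (a : GroupAlg d) : algAct V (c • a) = c • algAct V a := by
  simp [algAct]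

theorem algAct_sum {ι : Type*} (s : Finset ι) (f : ι → GroupAlg d) :
    algAct V (∑ i ∈ s, f i) = ∑ i ∈ s, algAct V (f i) := by
  simp [algAct]

theorem algAct_mul (a b : GroupAlg d) (w : TPow d V) :
    algAct V (a * b) w = algAct V b (algAct V a w) := by
  simp [algAct]

theorem algAct_eq_sum (a : GroupAlg d) (w : TPow d V) :
    algAct V a w = ∑ s : Equiv.Perm (Fin d), a.coeff s • permAct V s w := by
  classical
  induction a using MonoidAlgebra.induction_on with
  | of g =>
    rw [MonoidAlgebra.of_apply, algAct_single, Finset.sum_eq_single g]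
    · simp
    · intro h _ hh
      simp [hh.symm]
    · simp
  | add x y hx hy =>
    rw [algAct_add, LinearMap.add_apply, hx, hy, ← Finset.sum_add_distrib]
    simp only [MonoidAlgebra.coeff_add, Finsupp.add_apply, add_smul]
  | smul r x hx =>
    rw [algAct_smul, LinearMap.smul_apply, hx, Finset.smul_sum]
    simp only [MonoidAlgebra.coeff_smul, Finsupp.smul_apply, smul_smul, smul_eq_mul]

theorem tensorAct_algAct (f : Module.End ℂ V) (a : GroupAlg d) (w : TPow d V) :
    tensorAct d f (algAct V a w) = algAct V a (tensorAct d f w) := by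
  rw [algAct_eq_sum, algAct_eq_sum, map_sum]
  simp only [map_smul, tensorAct_permAct]

theorem tensorAct_one (w : TPow d V) : tensorAct d (1 : Module.End ℂ V) w = (d : ℂ) • w := by
  have h : tensorAct d (1 : Module.End ℂ V) = (d : ℂ) • LinearMap.id :=
    tensor_ext fun v => by
      rw [tensorAct_tprod]
      simp only [Module.End.one_apply, Function.update_eq_self, Finset.sum_const, Finset.card_univ,
        Fintype.card_fin, Nat.cast_smul_eq_nsmul]
      rfl
  rw [h]
  rfl

end PermutationAction

/-! ### Polarization: from derivations to symmetrized operators -/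

section Symmetrization

variable {d : ℕ} {V : Type*} [AddCommGroup V] [Module ℂ V]

/-- The symmetrization of `A_1 ⊗ ⋯ ⊗ A_d`. -/
noncomputable def symMap (A : Fin d → Module.End ℂ V) : Module.End ℂ (TPow d V) :=
  ∑ s : Equiv.Perm (Fin d), PiTensorProduct.map fun i => A (s i)

theorem symMap_tprod (A : Fin d → Module.End ℂ V) (v : Fin d → V) :
    symMap A (PiTensorProduct.tprod ℂ v) =
      ∑ s : Equiv.Perm (Fin d), PiTensorProduct.tprod ℂ fun i => A (s i) (v i) := by
  unfold symMap
  rw [LinearMap.sum_apply]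
  simp only [PiTensorProduct.map_tprod]

theorem symMap_comp_perm (A : Fin d → Module.End ℂ V) (t : Equiv.Perm (Fin d)) :
    symMap (fun i => A (t i)) = symMap A :=
  Fintype.sum_equiv (Equiv.mulLeft t) _ _ fun _ => rfl

theorem symMap_one : symMap (fun _ : Fin d => (1 : Module.End ℂ V)) = (d.factorial : ℂ) • 1 := by
  refine tensor_ext fun v => ?_
  rw [symMap_tprod]
  simp [Fintype.card_perm, Nat.cast_smul_eq_nsmul]

theorem symMap_tensorAct (A : Fin d → Module.End ℂ V) (Y : Module.End ℂ V) (w : TPow d V) :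
    symMap A (tensorAct d Y w) = ∑ j, symMap (Function.update A j (A j * Y)) w := by
  have h : symMap A ∘ₗ tensorAct d Y = ∑ j, symMap (Function.update A j (A j * Y)) := by
    refine tensor_ext fun v => ?_
    rw [LinearMap.comp_apply, tensorAct_tprod, map_sum, LinearMap.sum_apply]
    simp only [symMap_tprod]
    rw [Finset.sum_comm, Finset.sum_comm (s := Finset.univ (α := Fin d))]
    refine Finset.sum_congr rfl fun s _ => Fintype.sum_equiv s _ _ fun i => ?_
    congr 1
    funext k
    by_cases hk : k = i
    · subst hk
      simp
    · have hs : s k ≠ s i := fun e => hk (s.injective e)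
      rw [Function.update_of_ne hk, Function.update_of_ne hs]
  rw [← LinearMap.comp_apply, h, LinearMap.sum_apply]

/-- A subspace stable under the derivations induced by all endomorphisms of `V` is stable under
all symmetrized operators. -/
theorem symMap_mem (N : Submodule ℂ (TPow d V))
    (hN : ∀ f : Module.End ℂ V, ∀ w ∈ N, tensorAct d f w ∈ N) (A : Fin d → Module.End ℂ V) :
    ∀ w ∈ N, symMap A w ∈ N := by
  classical
  -- Induction on the number of nontrivial factors. Replacing one factor `A i₀` by `1` and composing
  -- with the derivation of `A i₀` gives copies of `symMap A`, plus terms with fewer nontrivial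
  -- factors.
  induction hm : (Finset.univ.filter fun i => A i ≠ 1).card using Nat.strong_induction_on
    generalizing A with
  | _ m ih =>
  subst hm
  intro w hw
  by_cases hA : ∀ i, A i = 1
  · have : A = fun _ => 1 := funext hA
    rw [this, symMap_one]
    exact N.smul_mem _ hw
  push Not at hA
  obtain ⟨i₀, hi₀⟩ := hA
  set A' := Function.update A i₀ 1 with hA'
  have hA'0 : A' i₀ = 1 := Function.update_self ..
  have hA'ne : ∀ k, k ≠ i₀ → A' k = A k := fun k hk => Function.update_of_ne hk ..
  have hlt : ∀ B : Fin d → Module.End ℂ V, (∀ k, B k ≠ 1 → A k ≠ 1 ∧ k ≠ i₀) →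
      (Finset.univ.filter fun i => B i ≠ 1).card < (Finset.univ.filter fun i => A i ≠ 1).card := by
    intro B hB
    refine Finset.card_lt_card (Finset.ssubset_iff_of_subset ?_ |>.2 ⟨i₀, by simpa using hi₀, ?_⟩)
    · intro k hk
      simp only [Finset.mem_filter, Finset.mem_univ, true_and] at hk ⊢
      exact (hB k hk).1
    · intro hk
      simp only [Finset.mem_filter, Finset.mem_univ, true_and] at hk
      exact (hB i₀ hk).2 rfl
  have hA'1 : ∀ k, A' k ≠ 1 → A k ≠ 1 ∧ k ≠ i₀ := by
    intro k hk
    have hki : k ≠ i₀ := fun e => hk (e ▸ hA'0)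
    exact ⟨hA'ne k hki ▸ hk, hki⟩
  have htot : ∑ j, symMap (Function.update A' j (A' j * A i₀)) w ∈ N := by
    rw [← symMap_tensorAct]
    exact ih _ (hlt A' hA'1) A' rfl _ (hN _ _ hw)
  rw [← Finset.sum_filter_add_sum_filter_not Finset.univ (fun j => A' j = 1)] at htot
  have hrest : ∑ j ∈ Finset.univ.filter (fun j => ¬ A' j = 1),
      symMap (Function.update A' j (A' j * A i₀)) w ∈ N := by
    refine N.sum_mem fun j hj => ih _ (hlt _ fun k hk => ?_) _ rfl _ hw
    rw [Finset.mem_filter] at hj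
    by_cases hkj : k = j
    · subst hkj
      exact hA'1 k hj.2
    · rw [Function.update_of_ne hkj] at hk
      exact hA'1 k hk
  have hmain : ∀ j ∈ Finset.univ.filter (fun j => A' j = 1),
      symMap (Function.update A' j (A' j * A i₀)) w = symMap A w := by
    intro j hj
    rw [Finset.mem_filter] at hj
    -- Placing `A i₀` in a slot `j` that holds `1` only permutes the factors of `A`.
    rw [hj.2, one_mul, ← symMap_comp_perm A (Equiv.swap i₀ j)]
    congr 2
    funext k
    by_cases hkj : k = j
    · subst hkj
      rw [Function.update_self, Equiv.swap_apply_right]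
    · rw [Function.update_of_ne hkj]
      by_cases hk : k = i₀
      · subst hk
        rw [Equiv.swap_apply_left, hA'0, ← hA'ne j (Ne.symm hkj), hj.2]
      · rw [Equiv.swap_apply_of_ne_of_ne hk hkj, hA'ne k hk]
  have h1 := (N.add_mem_iff_left hrest).1 htot
  rw [Finset.sum_congr rfl hmain, Finset.sum_const, ← Nat.cast_smul_eq_nsmul ℂ] at h1
  refine (N.smul_mem_iff ?_).1 h1
  rw [Nat.cast_ne_zero]
  -- The number of copies of `symMap A w` is nonzero: slot `i₀` itself contributes one.
  exact Finset.card_ne_zero_of_mem (a := i₀) (by simp [hA'0])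

end Symmetrization

/-! ### Coordinates and the product form on tensors -/

section Coordinates

variable {n d : ℕ}

/-- The coordinate functionals on the tensor power of the natural module. -/
noncomputable def coord (j : Fin d → Fin (n + 1)) : TPow d (NatMod n) →ₗ[ℂ] ℂ :=
  PiTensorProduct.lift
    ((MultilinearMap.mkPiAlgebra ℂ (Fin d) ℂ).compLinearMap fun i => LinearMap.proj (j i))

theorem coord_tprod (j : Fin d → Fin (n + 1)) (v : Fin d → NatMod n) :
    coord j (PiTensorProduct.tprod ℂ v) = ∏ i, v i (j i) := by
  unfold coord
  rw [PiTensorProduct.lift.tprod]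
  rfl

theorem sum_coord_smul (w : TPow d (NatMod n)) :
    ∑ j : Fin d → Fin (n + 1), coord j w • PiTensorProduct.tprod ℂ
      (fun i => (Pi.single (j i) 1 : NatMod n)) = w := by
  have h : ∑ j : Fin d → Fin (n + 1), (coord j).smulRight (PiTensorProduct.tprod ℂ
      (fun i => (Pi.single (j i) 1 : NatMod n))) = LinearMap.id := by
    refine tensor_ext fun v => ?_
    rw [LinearMap.sum_apply, LinearMap.id_apply]
    have hv : v = fun i => ∑ k : Fin (n + 1), v i k • (Pi.single k 1 : NatMod n) := by
      funext i
      exact (pi_eq_sum_univ' (v i))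
    conv_rhs => rw [hv, MultilinearMap.map_sum]
    refine Finset.sum_congr rfl fun j _ => ?_
    rw [MultilinearMap.map_smul_univ, LinearMap.smulRight_apply, coord_tprod]
  have := LinearMap.congr_fun h w
  rwa [LinearMap.sum_apply] at this

theorem exists_coord_ne_zero {w : TPow d (NatMod n)} (hw : w ≠ 0) : ∃ j, coord j w ≠ 0 := by
  by_contra! h
  apply hw
  rw [← sum_coord_smul w]
  simp [h]

variable (n d) in
/-- The product form on the tensor power of the natural module. -/
noncomputable def tensorForm : LinearMap.BilinForm ℂ (TPow d (NatMod n)) :=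
  ∑ j : Fin d → Fin (n + 1), (LinearMap.mul ℂ ℂ).compl₁₂ (coord j) (coord j)

theorem tensorForm_apply (w u : TPow d (NatMod n)) :
    tensorForm n d w u = ∑ j, coord j w * coord j u := by
  simp [tensorForm]

theorem tensorForm_comm (w u : TPow d (NatMod n)) : tensorForm n d w u = tensorForm n d u w := by
  simp only [tensorForm_apply, mul_comm]

theorem tensorForm_tprod (v u : Fin d → NatMod n) :
    tensorForm n d (PiTensorProduct.tprod ℂ v) (PiTensorProduct.tprod ℂ u) =
      ∏ i, dotForm n (v i) (u i) := by
  simp only [tensorForm_apply, coord_tprod, dotForm_apply, Finset.prod_univ_sum,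
    Finset.prod_mul_distrib, Fintype.piFinset_univ]

theorem tensorForm_permAct (s : Equiv.Perm (Fin d)) (w u : TPow d (NatMod n)) :
    tensorForm n d (permAct _ s w) u = tensorForm n d w (permAct _ s⁻¹ u) := by
  have h : tensorForm n d ∘ₗ permAct _ s = (tensorForm n d).compl₂ (permAct _ s⁻¹) := by
    refine tensor_ext₂ fun v u => ?_
    rw [LinearMap.comp_apply, LinearMap.compl₂_apply, permAct_tprod, permAct_tprod,
      tensorForm_tprod, tensorForm_tprod]
    refine Fintype.prod_equiv s _ _ fun i => ?_
    simp
  exact LinearMap.congr_fun₂ h w u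

/-- Permutations are orthogonal for the product form, so the adjoint comes from inversion. -/
theorem tensorForm_algAct (a : GroupAlg d) (w u : TPow d (NatMod n)) :
    tensorForm n d (algAct _ a w) u = tensorForm n d w (algAct _ (invAlg a) u) := by
  rw [algAct_eq_sum, algAct_eq_sum, map_sum, map_sum, LinearMap.sum_apply]
  refine Fintype.sum_equiv (Equiv.inv _) _ _ fun s => ?_
  rw [map_smul, map_smul, LinearMap.smul_apply, tensorForm_permAct, coeff_invAlg]
  simp

theorem tensorForm_tensorAct {f g : Module.End ℂ (NatMod n)}
    (hfg : ∀ v w, dotForm n (f v) w = dotForm n v (g w)) (w u : TPow d (NatMod n)) :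
    tensorForm n d (tensorAct d f w) u = tensorForm n d w (tensorAct d g u) := by
  have h : tensorForm n d ∘ₗ tensorAct d f = (tensorForm n d).compl₂ (tensorAct d g) := by
    refine tensor_ext₂ fun v u => ?_
    rw [LinearMap.comp_apply, LinearMap.compl₂_apply, tensorAct_tprod, tensorAct_tprod, map_sum,
      map_sum, LinearMap.sum_apply]
    refine Finset.sum_congr rfl fun i _ => ?_
    rw [tensorForm_tprod, tensorForm_tprod]
    refine Finset.prod_congr rfl fun k _ => ?_
    by_cases hk : k = i
    · subst hk
      rw [Function.update_self, Function.update_self, hfg]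
    · rw [Function.update_of_ne hk, Function.update_of_ne hk]
  exact LinearMap.congr_fun₂ h w u

/-- The element `∑ s, x_j(x · s⁻¹) s` of the group algebra, with `x_j` a coordinate functional. -/
noncomputable def averageElt (j : Fin d → Fin (n + 1)) (x : TPow d (NatMod n)) : GroupAlg d :=
  ∑ s : Equiv.Perm (Fin d), MonoidAlgebra.single s (coord j (permAct _ s⁻¹ x))

theorem coeff_averageElt (j : Fin d → Fin (n + 1)) (x : TPow d (NatMod n))
    (s : Equiv.Perm (Fin d)) : (averageElt j x).coeff s = coord j (permAct _ s⁻¹ x) := by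
  classical
  unfold averageElt
  rw [MonoidAlgebra.coeff_sum, Finsupp.finsetSum_apply, Finset.sum_eq_single s]
  · simp
  · intro t _ ht
    simp [ht]
  · simp

theorem coeff_averageElt_mul_one (j : Fin d → Fin (n + 1)) (x : TPow d (NatMod n))
    (a : GroupAlg d) : (averageElt j x * a).coeff 1 = coord j (algAct _ a x) := by
  rw [coeff_mul_one, algAct_eq_sum, map_sum]
  refine Fintype.sum_equiv (Equiv.inv _) _ _ fun s => ?_
  rw [coeff_averageElt, map_smul, smul_eq_mul, mul_comm]
  rfl

/-- For `y` a pure tensor, `y · averageElt j x` is the image of `x` under a symmetrized product of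
rank-one operators, so polarization applies. -/
theorem algAct_averageElt_mem (N : Submodule ℂ (TPow d (NatMod n)))
    (hN : ∀ f : Module.End ℂ (NatMod n), ∀ w ∈ N, tensorAct d f w ∈ N)
    (j : Fin d → Fin (n + 1)) {x : TPow d (NatMod n)} (hx : x ∈ N) (y : TPow d (NatMod n)) :
    algAct _ (averageElt j x) y ∈ N := by
  induction y using PiTensorProduct.induction_on with
  | add y z hy hz => rw [map_add]; exact N.add_mem hy hz
  | smul_tprod r y =>
  rw [map_smul]
  apply N.smul_mem
  -- `A i` reads coordinate `j i` and returns that multiple of `y i`.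
  let A : Fin d → Module.End ℂ (NatMod n) := fun i => (LinearMap.proj (j i)).smulRight (y i)
  have h : symMap A = ∑ s : Equiv.Perm (Fin d), (coord j ∘ₗ permAct _ s⁻¹).smulRight
      (permAct _ s (PiTensorProduct.tprod ℂ y)) := by
    refine tensor_ext fun v => ?_
    rw [symMap_tprod, LinearMap.sum_apply]
    refine Finset.sum_congr rfl fun s _ => ?_
    rw [LinearMap.smulRight_apply, LinearMap.comp_apply, permAct_tprod, permAct_tprod, coord_tprod]
    refine (MultilinearMap.map_smul_univ (PiTensorProduct.tprod ℂ) (fun i => v i (j (s i)))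
      (fun i => y (s i))).trans ?_
    congr 1
    refine Fintype.prod_equiv s _ _ fun i => ?_
    simp
  have hmem := symMap_mem N hN A x hx
  rw [h, LinearMap.sum_apply] at hmem
  rw [algAct_eq_sum]
  simp only [coeff_averageElt]
  exact hmem

end Coordinates

/-! ### Maps into and out of the Schur module -/

section SchurMaps

variable {lam : YoungDiagram} {d : ℕ} (U : lam.cells ≃ Fin d) {V : Type*} [AddCommGroup V]
  [Module ℂ V]

variable (V) in
/-- The map `w ↦ w ⊗ σ_U`. -/
noncomputable def schurOf : TPow d V →ₗ[ℂ] SchurModule U V :=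
  schurProj U V ∘ₗ (TensorProduct.mk ℂ (TPow d V) (specht U)).flip (youngSymMem U)

theorem schurOf_apply (w : TPow d V) :
    schurOf U V w = schurProj U V (w ⊗ₜ[ℂ] youngSymMem U) := rfl

theorem schurOf_tprod (v : Fin d → V) :
    schurOf U V (PiTensorProduct.tprod ℂ v) = schurMk U v := rfl

theorem schurProj_permAct (s : Equiv.Perm (Fin d)) (w : TPow d V) (b : specht U) :
    schurProj U V (permAct V s w ⊗ₜ[ℂ] b) =
      schurProj U V (w ⊗ₜ[ℂ] ((MonoidAlgebra.single s (1 : ℂ) : GroupAlg d) • b)) := by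
  rw [← sub_eq_zero, ← map_sub]
  exact (Submodule.Quotient.mk_eq_zero _).2 (Submodule.subset_span ⟨w, s, b, rfl⟩)

theorem schurProj_algAct (a : GroupAlg d) (w : TPow d V) (b : specht U) :
    schurProj U V (algAct V a w ⊗ₜ[ℂ] b) = schurProj U V (w ⊗ₜ[ℂ] (a • b)) := by
  induction a using MonoidAlgebra.induction_on with
  | of g =>
    rw [MonoidAlgebra.of_apply, algAct_single, one_smul, schurProj_permAct]
  | add x y hx hy =>
    rw [algAct_add, LinearMap.add_apply, TensorProduct.add_tmul, map_add, hx, hy, add_smul,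
      TensorProduct.tmul_add, map_add]
  | smul r x hx =>
    have h : (r • x) • b = r • (x • b) := smul_assoc r x b
    rw [algAct_smul, LinearMap.smul_apply, ← TensorProduct.smul_tmul', LinearMap.map_smul, hx, h,
      TensorProduct.tmul_smul r, LinearMap.map_smul]

theorem schurOf_algAct {a : GroupAlg d} {c : ℂ} (h : a * youngSym U = c • youngSym U)
    (w : TPow d V) : schurOf U V (algAct V a w) = c • schurOf U V w := by
  have h' : a • youngSymMem U = c • youngSymMem U := Subtype.ext h
  rw [schurOf_apply, schurProj_algAct, h', TensorProduct.tmul_smul, map_smul, schurOf_apply]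

/-- Every element of the ideal is `a σ_U`, and `w ⊗ a σ_U = w·a ⊗ σ_U`. -/
theorem schurOf_surjective : Function.Surjective (schurOf U V) := by
  intro x
  obtain ⟨z, rfl⟩ := schurProj_surjective U x
  induction z using TensorProduct.induction_on with
  | zero => exact ⟨0, by rw [map_zero, map_zero]⟩
  | tmul w b =>
    obtain ⟨b, hb⟩ := b
    obtain ⟨a, rfl⟩ := Submodule.mem_span_singleton.1 hb
    exact ⟨algAct V a w, by rw [schurOf_apply, schurProj_algAct]; rfl⟩
  | add y z hy hz =>
    obtain ⟨v, hv⟩ := hy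
    obtain ⟨w, hw⟩ := hz
    exact ⟨v + w, by rw [map_add, map_add, hv, hw]⟩

theorem schurAct_schurOf (f : Module.End ℂ V) (w : TPow d V) :
    schurAct U f (schurOf U V w) = schurOf U V (tensorAct d f w) := by
  rw [schurOf_apply, schurAct_mk, TensorProduct.map_tmul]
  rfl

theorem lie_schurOf {n : ℕ} (x : sl n) (w : TPow d (NatMod n)) :
    ⁅x, schurOf U (NatMod n) w⁆ =
      schurOf U (NatMod n) (tensorAct d (LieModule.toEnd ℂ (sl n) (NatMod n) x) w) :=
  schurAct_schurOf U _ w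

theorem schur_hom_ext {E : Type*} [AddCommGroup E] [Module ℂ E] {F G : SchurModule U V →ₗ[ℂ] E}
    (h : ∀ v : Fin d → V, F (schurMk U v) = G (schurMk U v)) : F = G := by
  have h' : F ∘ₗ schurOf U V = G ∘ₗ schurOf U V := tensor_ext h
  refine LinearMap.ext fun x => ?_
  obtain ⟨w, rfl⟩ := schurOf_surjective U x
  exact LinearMap.congr_fun h' w

theorem IsSchurForm.unique {ζ : LinearMap.BilinForm ℂ V}
    {F G : LinearMap.BilinForm ℂ (SchurModule U V)} (hF : IsSchurForm U ζ F)
    (hG : IsSchurForm U ζ G) : F = G :=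
  schur_hom_ext U fun v => schur_hom_ext U fun u => (hF v u).trans (hG v u).symm

variable (V) in
/-- The map `w ⊗ b ↦ w · b` from the Schur module to the tensor power. -/
noncomputable def schurToTensor : SchurModule U V →ₗ[ℂ] TPow d V :=
  (balanced U V).liftQ
    (TensorProduct.lift (LinearMap.mk₂ ℂ (fun w (b : specht U) => algAct V (b : GroupAlg d) w)
      (fun w w' b => map_add _ w w') (fun c w b => map_smul _ c w)
      (fun w b b' => by
        rw [Submodule.coe_add, algAct_add, LinearMap.add_apply])
      (fun c w b => by
        rw [Submodule.coe_smul_of_tower, algAct_smul, LinearMap.smul_apply])))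
    (by
      unfold balanced
      rw [Submodule.span_le]
      rintro z ⟨w, s, b, rfl⟩
      rw [SetLike.mem_coe, LinearMap.mem_ker, map_sub, TensorProduct.lift.tmul,
        TensorProduct.lift.tmul, LinearMap.mk₂_apply, LinearMap.mk₂_apply, Submodule.coe_smul,
        smul_eq_mul, algAct_mul, algAct_single, one_smul, sub_self])

instance [FiniteDimensional ℂ V] : FiniteDimensional ℂ (SchurModule U V) :=
  Module.Finite.of_surjective (schurOf U V) (schurOf_surjective U)

end SchurMaps

/-! ### The form on the Schur module -/

section SchurForms

variable {lam : YoungDiagram} {d : ℕ} (U : lam.cells ≃ Fin d) (n : ℕ)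

/-- The bilinear form on the Schur module of the natural module. -/
noncomputable def schurForm : LinearMap.BilinForm ℂ (SchurModule U (NatMod n)) :=
  (youngCoeff U)⁻¹ • (tensorForm n d).compl₁₂
    (algAct _ (colSum U) ∘ₗ schurToTensor U (NatMod n)) (schurToTensor U (NatMod n))

/-- Pulling the form back along `w ⊗ b ↦ w·b` makes it well defined at once. Moving the second `σ`
across as `ργ` leaves `σγ·ργ = σ²γ = kγργ`, and the factor `k⁻¹` in the definition cancels `k`. -/
theorem schurForm_schurOf (w u : TPow d (NatMod n)) :
    schurForm U n (schurOf U _ w) (schurOf U _ u) =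
      tensorForm n d (algAct _ (colRowCol U) w) u := by
  have h : youngSym U * colSum U * (rowSum U * colSum U) = youngCoeff U • colRowCol U := by
    have : youngSym U * colSum U * (rowSum U * colSum U) =
        youngSym U * youngSym U * colSum U := by
      simp only [youngSym, mul_assoc]
    rw [this, youngSym_mul_youngSym, smul_mul_assoc]
    rfl
  have hinv : invAlg (youngSym U) = rowSum U * colSum U := by
    rw [youngSym, invAlg_mul, invAlg_rowSum, invAlg_colSum]
  change (youngCoeff U)⁻¹ * tensorForm n d
    (algAct _ (colSum U) (algAct _ (youngSym U) w)) (algAct _ (youngSym U) u) = _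
  rw [tensorForm_comm, tensorForm_algAct, hinv, ← algAct_mul, ← algAct_mul, ← mul_assoc, h,
    tensorForm_comm, algAct_smul, LinearMap.smul_apply, map_smul, LinearMap.smul_apply, smul_eq_mul,
    inv_mul_cancel_left₀ (youngCoeff_ne_zero U)]

theorem colRowCol_eq_sum : colRowCol U = ∑ c : colGroup U, ∑ r : rowGroup U, ∑ c' : colGroup U,
    MonoidAlgebra.single ((c : Equiv.Perm (Fin d)) * r * c')
      (sgn (c : Equiv.Perm (Fin d)) * sgn (c' : Equiv.Perm (Fin d))) := by
  unfold colRowCol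
  rw [← youngSym, youngSym_eq_sum]
  unfold colSum
  simp only [Finset.sum_mul]
  refine Finset.sum_congr rfl fun c _ => Finset.sum_congr rfl fun r _ => ?_
  simp only [Finset.mul_sum, MonoidAlgebra.single_mul_single]

theorem isSchurForm_schurForm : IsSchurForm U (dotForm n) (schurForm U n) := by
  intro v u
  rw [← schurOf_tprod, ← schurOf_tprod, schurForm_schurOf, colRowCol_eq_sum]
  simp only [algAct_sum, algAct_single, LinearMap.sum_apply, LinearMap.smul_apply, map_sum,
    map_smul, permAct_tprod, tensorForm_tprod, smul_eq_mul]

theorem schurForm_comm (x y : SchurModule U (NatMod n)) :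
    schurForm U n x y = schurForm U n y x := by
  obtain ⟨w, rfl⟩ := schurOf_surjective U x
  obtain ⟨u, rfl⟩ := schurOf_surjective U y
  rw [schurForm_schurOf, schurForm_schurOf, tensorForm_algAct, invAlg_colRowCol, tensorForm_comm]

theorem isContravariant_schurForm : IsContravariant n (schurForm U n) := by
  rw [isContravariant_iff]
  intro z x y
  obtain ⟨w, rfl⟩ := schurOf_surjective U x
  obtain ⟨u, rfl⟩ := schurOf_surjective U y
  rw [lie_schurOf, lie_schurOf, schurForm_schurOf, schurForm_schurOf, ← tensorAct_algAct]
  have h : ∀ v w, dotForm n (LieModule.toEnd ℂ (sl n) (NatMod n) z v) w =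
      dotForm n v (LieModule.toEnd ℂ (sl n) (NatMod n) (tau n z) w) := fun v w => by
    rw [LieModule.toEnd_apply_apply, LieModule.toEnd_apply_apply, natMod_lie, natMod_lie,
      dotForm_mulVec]
    rfl
  exact tensorForm_tensorAct h _ _

theorem IsContravariant.smul {V : Type*} [AddCommGroup V] [Module ℂ V] [LieRingModule (sl n) V]
    [LieModule ℂ (sl n) V] {β : LinearMap.BilinForm ℂ V} (hβ : IsContravariant n β) (c : ℂ) :
    IsContravariant n (c • β) := fun u x y => by
  rw [LinearMap.smul_apply, LinearMap.smul_apply, LinearMap.smul_apply, LinearMap.smul_apply, hβ]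

theorem coeff_rowSum (g : Equiv.Perm (Fin d)) :
    (rowSum U).coeff g = if g ∈ rowGroup U then 1 else 0 := by
  classical
  unfold rowSum
  rw [MonoidAlgebra.coeff_sum, Finsupp.finsetSum_apply]
  simp only [MonoidAlgebra.coeff_single, Finsupp.single_apply]
  split_ifs with hg
  · rw [Finset.sum_eq_single (⟨g, hg⟩ : rowGroup U)]
    · simp
    · intro r _ hr
      rw [if_neg fun e => hr (Subtype.ext e)]
    · simp
  · refine Finset.sum_eq_zero fun r _ => ?_
    rw [if_neg fun e : (r : Equiv.Perm (Fin d)) = g => hg (e ▸ r.2)]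

variable {n} in
theorem rowOf_le (hrows : lam.colLen 0 ≤ n + 1) (i : Fin d) : rowOf U i ≤ n := by
  have h1 := rowOf_lt_colLen U i
  have h2 := lam.colLen_anti 0 (colOf U i) (Nat.zero_le _)
  omega

variable {n} in
-- By orthonormality `g` contributes its coefficient in `γργ` exactly when it preserves rows. Since
-- the row group is closed under inverses, the sum is the identity coefficient of `γργ·ρ = σ²`. The
-- bound on the rows keeps all the basis vectors nonzero.
theorem schurForm_schurVec (hrows : lam.colLen 0 ≤ n + 1) :
    schurForm U n (schurVec n U) (schurVec n U) = youngCoeff U := by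
  have h : colRowCol U * rowSum U = youngSym U * youngSym U := by
    simp only [colRowCol, youngSym, mul_assoc]
  unfold schurVec youngCoeff
  rw [← schurOf_tprod, schurForm_schurOf, ← h, coeff_mul_one, algAct_eq_sum, map_sum,
    LinearMap.sum_apply]
  refine Finset.sum_congr rfl fun g _ => ?_
  rw [map_smul, LinearMap.smul_apply, smul_eq_mul, permAct_tprod, tensorForm_tprod, coeff_rowSum]
  congr 1
  simp only [dotForm_basisVec n (rowOf_le U hrows _), inv_mem_iff, Finset.prod_ite_zero,
    Finset.prod_const_one, Finset.mem_univ, true_implies]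
  rfl

end SchurForms

/-! ### Highest weight vector and irreducibility -/

section Irreducibility

variable {lam : YoungDiagram} {d : ℕ} (U : lam.cells ≃ Fin d) {n : ℕ}

theorem schurVec_ne_zero (hrows : lam.colLen 0 ≤ n + 1) : schurVec n U ≠ 0 := by
  intro h
  have := schurForm_schurVec U hrows
  rw [h, map_zero] at this
  exact youngCoeff_ne_zero U this.symm

theorem schurVec_mem_weightSpace (hrows : lam.colLen 0 ≤ n + 1) :
    schurVec n U ∈ weightSpace n (SchurModule U (NatMod n)) (diagramWeight n lam) := by
  intro h
  let row : Fin d → Fin (n + 1) := fun i => ⟨rowOf U i, Nat.lt_succ_of_le (rowOf_le U hrows i)⟩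
  let A : Matrix (Fin (n + 1)) (Fin (n + 1)) ℂ := (h : sl n)
  have hA : ∀ i, LieModule.toEnd ℂ (sl n) (NatMod n) h (basisVec n (rowOf U i)) =
      A (row i) (row i) • basisVec n (rowOf U i) := fun i =>
    isDiag_mulVec_basisVec h.2 (row i)
  have hsum : ∑ i, A (row i) (row i) = diagramWeight n lam h := by
    change _ = ∑ r : Fin (n + 1), (lam.rowLen r : ℂ) * A r r
    rw [← Finset.sum_fiberwise Finset.univ row]
    refine Finset.sum_congr rfl fun r _ => ?_
    rw [Finset.sum_congr rfl (g := fun _ => A r r)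
      (fun i hi => by rw [(Finset.mem_filter.1 hi).2]), Finset.sum_const, ← card_rowOf_eq U,
      nsmul_eq_mul]
    simp only [row, Fin.ext_iff]
  unfold schurVec
  rw [← schurOf_tprod, lie_schurOf, tensorAct_tprod, ← hsum, Finset.sum_smul, map_sum]
  refine Finset.sum_congr rfl fun i _ => ?_
  rw [hA, MultilinearMap.map_update_smul, Function.update_eq_self, map_smul]

/-- The transposition of the two boxes fixes the tensor but acts on `σ_U` by `-1`. -/
theorem schurMk_eq_zero_of_eq {m m' : Fin d} (hm : m ≠ m') (hcol : colOf U m = colOf U m')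
    {V : Type*} [AddCommGroup V] [Module ℂ V] (v : Fin d → V) (hv : v m = v m') :
    schurMk U v = 0 := by
  have hc : Equiv.swap m m' ∈ colGroup U := by
    intro k
    rw [Equiv.swap_apply_def]
    split_ifs with h1 h2
    · rw [h1, hcol]
    · rw [h2, hcol]
    · rfl
  have hmul : MonoidAlgebra.single (Equiv.swap m m') 1 * youngSym U = (-1 : ℂ) • youngSym U := by
    rw [youngSym, ← mul_assoc, single_mul_colSum U hc, sgn_swap hm, smul_mul_assoc]
  have h := schurOf_algAct U hmul (PiTensorProduct.tprod ℂ v)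
  rw [algAct_single, one_smul, permAct_tprod, schurOf_tprod, schurOf_tprod] at h
  have hv' : (fun i => v (Equiv.swap m m' i)) = v := by
    funext i
    rw [Equiv.swap_apply_def]
    split_ifs with h1 h2
    · rw [h1, hv]
    · rw [h2, hv]
    · rfl
  rw [hv', neg_one_smul] at h
  have h2 : (2 : ℂ) • schurMk U v = 0 := by
    rw [two_smul]
    nth_rewrite 1 [h]
    exact neg_add_cancel _
  exact (smul_eq_zero.1 h2).resolve_left two_ne_zero

theorem single_lie_basisVec {i j : Fin (n + 1)} (hij : i ≠ j) (k : ℕ) :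
    ⁅LieAlgebra.SpecialLinear.single i j hij (1 : ℂ), basisVec n k⁆ =
      if k = j then basisVec n i else 0 := by
  rw [natMod_lie]
  change (Matrix.single i j (1 : ℂ)).mulVec _ = _
  ext l
  rw [Matrix.single_mulVec]
  by_cases hk : k = j
  · rw [if_pos hk, hk]
    by_cases hl : l = i
    · subst hl
      simp [basisVec]
    · have : (l : ℕ) ≠ i := fun e => hl (Fin.ext e)
      simp [basisVec, hl, this]
  · rw [if_neg hk]
    simp [basisVec, Ne.symm hk]

/-- Each term replaces the entry `j` of one box by `i < j`. The box of row `i` in the same column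
already carries `i`, so the column has a repeated entry. -/
theorem single_lie_schurVec {i j : Fin (n + 1)} (hij : i < j) :
    ⁅LieAlgebra.SpecialLinear.single i j hij.ne (1 : ℂ), schurVec n U⁆ = 0 := by
  unfold schurVec
  rw [← schurOf_tprod, lie_schurOf, tensorAct_tprod, map_sum]
  refine Finset.sum_eq_zero fun m _ => ?_
  rw [LieModule.toEnd_apply_apply, single_lie_basisVec, schurOf_tprod]
  split_ifs with hm
  · have hlt : (i : ℕ) < lam.colLen (colOf U m) := by
      have := rowOf_lt_colLen U m
      have : (i : ℕ) < j := hij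
      omega
    obtain ⟨m', hr, hc⟩ := exists_box U hlt
    have hne : m ≠ m' := by
      rintro rfl
      have : (i : ℕ) < j := hij
      omega
    refine schurMk_eq_zero_of_eq U hne hc.symm _ ?_
    rw [Function.update_self, Function.update_of_ne hne.symm, hr]
  · rw [← schurOf_tprod, MultilinearMap.map_update_zero, map_zero]

/-- A nonzero `w ⊗ σ` in `N` yields an element `a` with every `y·σa ⊗ σ = y ⊗ σaσ` in `N`, and `σaσ`
is a nonzero multiple of `σ`. -/
theorem isIrreducible_schurModule (hrows : lam.colLen 0 ≤ n + 1) :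
    LieModule.IsIrreducible ℂ (sl n) (SchurModule U (NatMod n)) := by
  have : Nontrivial (SchurModule U (NatMod n)) := ⟨_, _, schurVec_ne_zero U hrows⟩
  refine LieModule.IsIrreducible.mk fun N hN => ?_
  obtain ⟨ξ, hξ, hξ0⟩ : ∃ v ∈ N, v ≠ 0 := by
    by_contra! hcon
    exact hN ((LieSubmodule.eq_bot_iff N).2 hcon)
  obtain ⟨w, rfl⟩ := schurOf_surjective U ξ
  let N' : Submodule ℂ (TPow d (NatMod n)) := N.toSubmodule.comap (schurOf U (NatMod n))
  have hN' : ∀ f : Module.End ℂ (NatMod n), ∀ w ∈ N', tensorAct d f w ∈ N' := by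
    intro f w hw
    obtain ⟨x, c, hx⟩ := exists_sl_add_scalar n (LinearMap.toMatrix' f)
    -- Stability passes from traceless to all endomorphisms because the identity of `V` acts as the
    -- scalar `d`.
    have hf : f = LieModule.toEnd ℂ (sl n) (NatMod n) x + c • 1 := by
      refine LinearMap.ext fun v => ?_
      rw [← LinearMap.toMatrix'_mulVec, hx, Matrix.add_mulVec, Matrix.smul_mulVec,
        Matrix.one_mulVec]
      rfl
    change schurOf U _ (tensorAct d f w) ∈ N
    rw [← schurAct_schurOf, hf, schurAct_add, schurAct_smul, LinearMap.add_apply,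
      LinearMap.smul_apply, schurAct_schurOf U 1, tensorAct_one, map_smul]
    exact N.add_mem (N.lie_mem (x := x) hw) (N.smul_mem _ (N.smul_mem _ hw))
  have hk := youngCoeff_ne_zero U
  -- Replacing `w` by `w·σ` gives `x·σ = k x`, which makes the scalar in `σaσ` computable: it is `k²
  -- x_j(x)`, nonzero for a suitable `j`.
  set x := algAct (NatMod n) (youngSym U) w with hx
  have hxw : schurOf U _ x = youngCoeff U • schurOf U _ w :=
    schurOf_algAct U (youngSym_mul_youngSym U) w
  have hxN : x ∈ N' := by
    change schurOf U _ x ∈ N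
    rw [hxw]
    exact N.smul_mem _ hξ
  have hx0 : x ≠ 0 := by
    intro h0
    rw [h0, map_zero] at hxw
    exact (smul_ne_zero hk hξ0) hxw.symm
  have hxσ : algAct (NatMod n) (youngSym U) x = youngCoeff U • x := by
    rw [hx, ← algAct_mul, youngSym_mul_youngSym, algAct_smul, LinearMap.smul_apply]
  obtain ⟨j, hj⟩ := exists_coord_ne_zero hx0
  set a := averageElt j x with ha
  have hcoeff : (youngSym U * a * youngSym U).coeff 1 =
      youngCoeff U * (youngCoeff U * coord j x) := by
    rw [coeff_mul_one_comm, ← mul_assoc, youngSym_mul_youngSym, smul_mul_assoc,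
      MonoidAlgebra.coeff_smul, Finsupp.smul_apply, coeff_mul_one_comm, ha,
      coeff_averageElt_mul_one, hxσ, map_smul, smul_eq_mul, smul_eq_mul]
  rw [eq_top_iff]
  intro η _
  obtain ⟨y, rfl⟩ := schurOf_surjective U η
  have hmem : schurOf U _ (algAct _ a (algAct _ (youngSym U) y)) ∈ N :=
    algAct_averageElt_mem N' hN' j hxN (algAct _ (youngSym U) y)
  rw [← algAct_mul, schurOf_algAct U (youngSym_mul_mul_youngSym U a), hcoeff] at hmem
  exact (N.toSubmodule.smul_mem_iff (mul_ne_zero hk (mul_ne_zero hk hj))).1 hmem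

end Irreducibility

end SchurForm

/-! ### The main theorem -/

theorem mainTheorem12 (n d : ℕ) (lam : YoungDiagram) (hrows : lam.colLen 0 ≤ n + 1)
    (U : lam.cells ≃ Fin d) :
    (∃! β : LinearMap.BilinForm ℂ (SchurForm.NatMod n),
      SchurForm.IsTheContravariantForm n (SchurForm.firstWeight n)
        (SchurForm.basisVec n 0) β) ∧
    SchurForm.IsIrreducibleHighestWeight n (SchurForm.diagramWeight n lam)
      (SchurForm.schurVec n U) ∧
    ∃ k : ℤ, k ≠ 0 ∧
      SchurForm.youngSym U * SchurForm.youngSym U = (k : ℂ) • SchurForm.youngSym U ∧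
      ∀ β : LinearMap.BilinForm ℂ (SchurForm.NatMod n),
        SchurForm.IsTheContravariantForm n (SchurForm.firstWeight n)
          (SchurForm.basisVec n 0) β →
        ∃ βlam : LinearMap.BilinForm ℂ (SchurForm.SchurModule U (SchurForm.NatMod n)),
          SchurForm.IsSchurForm U β βlam ∧
          (∀ F : LinearMap.BilinForm ℂ (SchurForm.SchurModule U (SchurForm.NatMod n)),
            SchurForm.IsSchurForm U β F → F = βlam) ∧
          SchurForm.IsTheContravariantForm n (SchurForm.diagramWeight n lam)
            (SchurForm.schurVec n U) ((k : ℂ)⁻¹ • βlam) ∧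
          ((k : ℂ)⁻¹ • βlam).IsSymm ∧
          SchurForm.IsContravariant n ((k : ℂ)⁻¹ • βlam) ∧
          ((k : ℂ)⁻¹ • βlam) (SchurForm.schurVec n U) (SchurForm.schurVec n U) = 1 ∧
          (∀ F : LinearMap.BilinForm ℂ (SchurForm.SchurModule U (SchurForm.NatMod n)),
            SchurForm.IsContravariant n F →
            F (SchurForm.schurVec n U) (SchurForm.schurVec n U) = 1 →
            F = (k : ℂ)⁻¹ • βlam) := by
  have hirr := SchurForm.isIrreducible_schurModule U hrows
  obtain ⟨k, hk⟩ := SchurForm.exists_int_youngCoeff U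
  have hk0 : (k : ℂ) ≠ 0 := hk ▸ SchurForm.youngCoeff_ne_zero U
  refine ⟨⟨SchurForm.dotForm n, SchurForm.isTheContravariantForm_dotForm n,
    fun β hβ => hβ.eq_dotForm⟩,
    ⟨hirr, SchurForm.schurVec_ne_zero U hrows, SchurForm.schurVec_mem_weightSpace U hrows,
      fun i j hij => SchurForm.single_lie_schurVec U hij⟩,
    k, fun h => hk0 (by rw [h, Int.cast_zero]), hk ▸ SchurForm.youngSym_mul_youngSym U,
    fun β hβ => ?_⟩
  -- Uniqueness on `V` reduces an arbitrary contravariant form to the dot product, for which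
  -- `schurForm` was built.
  obtain rfl := hβ.eq_dotForm
  have hcontra := (SchurForm.isContravariant_schurForm U n).smul n (k : ℂ)⁻¹
  have hone : ((k : ℂ)⁻¹ • SchurForm.schurForm U n) (SchurForm.schurVec n U)
      (SchurForm.schurVec n U) = 1 := by
    rw [LinearMap.smul_apply, LinearMap.smul_apply, SchurForm.schurForm_schurVec U hrows, hk,
      smul_eq_mul, inv_mul_cancel₀ hk0]
  refine ⟨SchurForm.schurForm U n, SchurForm.isSchurForm_schurForm U n,
    fun F hF => hF.unique U (SchurForm.isSchurForm_schurForm U n),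
    hcontra.isTheContravariantForm (SchurForm.schurVec_mem_weightSpace U hrows) hone,
    ⟨fun x y => ?_⟩, hcontra, hone, fun F hF hF1 => hcontra.eq_of_apply_eq_one hF hone hF1⟩
  rw [LinearMap.smul_apply, LinearMap.smul_apply, LinearMap.smul_apply, LinearMap.smul_apply,
    SchurForm.schurForm_comm]
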